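/- **Theorem 2.3 (improved weighted Hardy inequality with gradient remainder).** Let $M$ be an $n$-dimensional complete noncompact (connected, smooth) Riemannian manifold with Riemannian volume $dx$, let $\Omega\subset M$ be a bounded domain (a non-empty connected open set of finite diameter; in particular it may have smooth boundary and contain the zeros of the weight $\rho$ below, but neither is required), let $1<q<2$ and $\alpha\in\mathbb R$. Then there is a constant $C_1>0$, depending only on $\Omega$ (hence on $M$ and $n$), $q$ and $\alpha$, such that the following holds. Let $C>0$ with $C+\alpha-1>0$, and let $\rho\ge 0$ be a locally Lipschitz function on $M$ such that $|\nabla\rho|=1$ almost everywhere and $\Delta\rho\ge \frac{C}{\rho}$ in the sense of distributions on $M$, i.e. $1/\rho$ is locally integrable and $$-\int_M\langle\nabla\rho,\nabla\eta\rangle\,dx\;\ge\;\int_M\frac{C}{\rho}\,\eta\,dx\qquad\text{for all } 0\le\eta\in C_c^\infty(M).$$ Then for every $\phi\in C_0^\infty(\Omega)$ $$\int_\Omega\rho^\alpha|\nabla\phi|^2\,dx\;\ge\;\Big(\frac{C+\alpha-1}{2}\Big)^2\int_\Omega\rho^{\alpha}\frac{\phi^2}{\rho^2}\,dx\;+\;C_1\Big(\int_\Omega|\nabla\phi|^q\rho^{q\alpha/2}\,dx\Big)^{2/q},$$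 where all integrals are integrals of nonnegative functions with values in $[0,+\infty]$. -/

import Mathlib

open MeasureTheory Bundle Manifold Set
open scoped ENNReal ContDiff Topology

noncomputable section

namespace RiemHardy

/-- The model space `ℝⁿ` with its Euclidean structure. -/
abbrev EucSp (n : ℕ) : Type := EuclideanSpace ℝ (Fin n)

section

variable {n : ℕ} {M : Type*} [TopologicalSpace M] [ChartedSpace (EucSp n) M]

lemma measurableSet_chart_preimage [MeasurableSpace M] [BorelSpace M] (c : M) {s : Set M}
    (hs : MeasurableSet s) :
    MeasurableSet ((chartAt (EucSp n) c).target ∩ (chartAt (EucSp n) c).symm ⁻¹' s) := by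
  have h := (continuousOn_iff_continuous_domRestrict.1
    (chartAt (EucSp n) c).continuousOn_symm).measurable hs
  have h2 := (chartAt (EucSp n) c).open_target.measurableSet.subtype_image h
  convert h2 using 1
  ext y
  simp [and_comm]

end

section

variable {n : ℕ} {M : Type*} [TopologicalSpace M] [ChartedSpace (EucSp n) M]
  [IsManifold 𝓘(ℝ, EucSp n) ∞ M]

variable (n) in
/-- The `i`-th coordinate vector field `∂/∂xᵢ` of the chart around `c`, at the point `x` (meaningful
when `x` lies in the domain of this chart). -/
def coordField (c : M) (i : Fin n) (x : M) : TangentSpace 𝓘(ℝ, EucSp n) x :=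
  (trivializationAt (EucSp n) (TangentSpace 𝓘(ℝ, EucSp n) (M := M)) c).symmL ℝ x
    (EuclideanSpace.basisFun (Fin n) ℝ i)

lemma coordField_change {c c' x : M} (hx : x ∈ (chartAt (EucSp n) c).source)
    (hx' : x ∈ (chartAt (EucSp n) c').source) (i : Fin n) :
    coordField n c i x = (trivializationAt (EucSp n)
      (TangentSpace 𝓘(ℝ, EucSp n) (M := M)) c').symmL ℝ x
        (tangentCoordChange 𝓘(ℝ, EucSp n) c c' x (EuclideanSpace.basisFun (Fin n) ℝ i)) := by
  have hI : ∀ z : M, (extChartAt 𝓘(ℝ, EucSp n) z).source = (chartAt (EucSp n) z).source :=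
    fun z => extChartAt_source _ z
  rw [coordField, TangentBundle.symmL_trivializationAt_eq_core hx,
    TangentBundle.symmL_trivializationAt_eq_core hx']
  refine (tangentCoordChange_comp (I := 𝓘(ℝ, EucSp n)) (w := c) (x := c') (y := x) (z := x)
    ⟨⟨?_, ?_⟩, ?_⟩).symm
  · rwa [hI]
  · rwa [hI]
  · rw [hI]; exact mem_chart_source _ x

variable [RiemannianBundle (fun x : M => TangentSpace 𝓘(ℝ, EucSp n) x)]

variable (n) in
/-- The matrix `gᵢⱼ = ⟨∂ᵢ, ∂ⱼ⟩` of the Riemannian metric in the chart around `c`. -/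
def metricMatrix (c x : M) : Matrix (Fin n) (Fin n) ℝ :=
  Matrix.of fun i j => inner ℝ (coordField n c i x) (coordField n c j x)

variable (n) in
/-- The measure `√(det gᵢⱼ) dx¹ ⋯ dxⁿ` on the domain of the chart around `c` (extended by zero to the
rest of `M`). -/
def chartVolume [MeasurableSpace M] (c : M) : Measure M :=
  (Measure.map (chartAt (EucSp n) c).symm
    ((volume : Measure (EucSp n)).restrict (chartAt (EucSp n) c).target)).withDensity
      fun x => ENNReal.ofReal (Real.sqrt (metricMatrix n c x).det)

variable (n M) in
/-- The Riemannian volume measure: the least measure that dominates `√(det gᵢⱼ) dx¹ ⋯ dxⁿ` in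
every chart. It coincides with this measure in every chart
(see `riemannianVolume_restrict_chart`). -/
def riemannianVolume [MeasurableSpace M] : Measure M := ⨆ c : M, chartVolume n c

lemma metricMatrix_change {c c' x : M} (hx : x ∈ (chartAt (EucSp n) c).source)
    (hx' : x ∈ (chartAt (EucSp n) c').source) :
    Real.sqrt (metricMatrix n c x).det =
      |(tangentCoordChange 𝓘(ℝ, EucSp n) c c' x).det| *
        Real.sqrt (metricMatrix n c' x).det := by
  set L := tangentCoordChange 𝓘(ℝ, EucSp n) c c' x with hL
  set b := (EuclideanSpace.basisFun (Fin n) ℝ).toBasis with hb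
  set J : Matrix (Fin n) (Fin n) ℝ := LinearMap.toMatrix b b (L : EucSp n →ₗ[ℝ] EucSp n) with hJ
  have hbi : ∀ i, b i = EuclideanSpace.basisFun (Fin n) ℝ i := fun i => by simp [hb]
  have hsum : ∀ i, coordField n c i x = ∑ k, J k i • coordField n c' k x := by
    intro i
    have h1 : L (EuclideanSpace.basisFun (Fin n) ℝ i)
        = ∑ k, J k i • EuclideanSpace.basisFun (Fin n) ℝ k := by
      conv_lhs => rw [← hbi, ← b.sum_repr (L (b i))]
      refine Finset.sum_congr rfl fun k _ => ?_
      rw [hJ, LinearMap.toMatrix_apply, hbi k]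
      rfl
    rw [coordField_change hx hx' i, ← hL, h1, map_sum]
    refine Finset.sum_congr rfl fun k _ => ?_
    rw [map_smul, coordField]
  have hG : metricMatrix n c x = J.transpose * metricMatrix n c' x * J := by
    ext i j
    simp only [metricMatrix, Matrix.of_apply, Matrix.mul_apply, Matrix.transpose_apply, hsum,
      sum_inner, inner_sum, inner_smul_left, inner_smul_right, Finset.sum_mul]
    simp only [Finset.mul_sum]
    refine Finset.sum_congr rfl fun k _ => Finset.sum_congr rfl fun l _ => ?_
    simp only [conj_trivial]
    ring
  have hdet : J.det = L.det := by
    rw [hJ, LinearMap.det_toMatrix]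
  rw [hG, Matrix.det_mul, Matrix.det_mul, Matrix.det_transpose, hdet,
    show L.det * (metricMatrix n c' x).det * L.det = L.det ^ 2 * (metricMatrix n c' x).det by ring,
    Real.sqrt_mul (sq_nonneg _), Real.sqrt_sq_eq_abs]

lemma measurable_density [MeasurableSpace M] [BorelSpace M]
    [IsContMDiffRiemannianBundle 𝓘(ℝ, EucSp n) ∞ (EucSp n)
      (fun x : M => TangentSpace 𝓘(ℝ, EucSp n) x)] (c : M) :
    Measurable fun x : M => ENNReal.ofReal (Real.sqrt (metricMatrix n c x).det) := by
  classical
  set S := (chartAt (EucSp n) c).source with hSdef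
  have hS : MeasurableSet S := (chartAt (EucSp n) c).open_source.measurableSet
  have hentry : ∀ i j, Measurable fun x => metricMatrix n c x i j := by
    intro i j
    have hc : ContinuousOn (fun x => metricMatrix n c x i j) S := by
      have hf : ∀ i, ContMDiffOn 𝓘(ℝ, EucSp n) (𝓘(ℝ, EucSp n).prod 𝓘(ℝ, EucSp n)) 1
          (fun x : M => (TotalSpace.mk' (EucSp n) x (coordField n c i x) :
            TotalSpace (EucSp n) (TangentSpace 𝓘(ℝ, EucSp n) (M := M)))) S := by
        intro i
        have := (trivializationAt (EucSp n) (TangentSpace 𝓘(ℝ, EucSp n) (M := M))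
          c).contMDiffOn_localFrame_baseSet (I := 𝓘(ℝ, EucSp n)) 1
            (EuclideanSpace.basisFun (Fin n) ℝ).toBasis i
        rw [TangentBundle.trivializationAt_baseSet] at this
        refine this.congr fun x hx => ?_
        have hx' : x ∈ (trivializationAt (EucSp n) (TangentSpace 𝓘(ℝ, EucSp n) (M := M))
          c).baseSet := by rwa [TangentBundle.trivializationAt_baseSet]
        rw [Trivialization.localFrame_apply_of_mem_baseSet _ _ hx']
        simp [coordField, Trivialization.basisAt, Trivialization.symmL_apply _ hx']
      have : IsContMDiffRiemannianBundle 𝓘(ℝ, EucSp n) 1 (EucSp n)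
          (fun x : M => TangentSpace 𝓘(ℝ, EucSp n) x) :=
        IsContMDiffRiemannianBundle.of_le (n := ∞) (by norm_cast)
      exact fun x hx => ((hf i x hx).inner_bundle (hf j x hx)).continuousWithinAt
    have h0 : ∀ x ∉ S, metricMatrix n c x i j = 0 := by
      intro x hx
      have hx' : x ∉ (trivializationAt (EucSp n) (TangentSpace 𝓘(ℝ, EucSp n) (M := M))
          c).baseSet := by rwa [TangentBundle.trivializationAt_baseSet]
      simp [metricMatrix, coordField, Trivialization.symmL_apply_of_notMem _ hx']
    have : (fun x => metricMatrix n c x i j) = S.piecewise (fun x => metricMatrix n c x i j) 0 := by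
      ext x
      by_cases hx : x ∈ S
      · simp [hx]
      · simp [hx, h0 x hx]
    rw [this]
    exact hc.measurable_piecewise continuousOn_const hS
  have hdet : Measurable fun x => (metricMatrix n c x).det := by
    simp only [Matrix.det_apply]
    exact Finset.measurable_sum _ fun σ _ =>
      (Finset.measurable_prod _ fun i _ => hentry _ _).const_smul _
  exact (hdet.sqrt).ennreal_ofReal

variable [MeasurableSpace M] [BorelSpace M]
    [IsContMDiffRiemannianBundle 𝓘(ℝ, EucSp n) ∞ (EucSp n)
      (fun x : M => TangentSpace 𝓘(ℝ, EucSp n) x)]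

lemma chartVolume_apply (c : M) {s : Set M} (hs : MeasurableSet s) :
    chartVolume n c s =
      ∫⁻ y in (chartAt (EucSp n) c).target ∩ (chartAt (EucSp n) c).symm ⁻¹' s,
        ENNReal.ofReal (Real.sqrt (metricMatrix n c ((chartAt (EucSp n) c).symm y)).det) := by
  have ht := (chartAt (EucSp n) c).open_target.measurableSet
  have hm : AEMeasurable (chartAt (EucSp n) c).symm
      ((volume : Measure (EucSp n)).restrict (chartAt (EucSp n) c).target) :=
    (chartAt (EucSp n) c).continuousOn_symm.aemeasurable ht
  rw [chartVolume, withDensity_apply _ hs, Measure.restrict_map_of_aemeasurable hm hs,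
    lintegral_map' (measurable_density c).aemeasurable (hm.mono_measure Measure.restrict_le_self),
    Measure.restrict_restrict' ht, inter_comm]

lemma chartVolume_compat (c c' : M) {s : Set M} (hs : MeasurableSet s)
    (hc : s ⊆ (chartAt (EucSp n) c).source) (hc' : s ⊆ (chartAt (EucSp n) c').source) :
    chartVolume n c s = chartVolume n c' s := by
  set e := chartAt (EucSp n) c
  set e' := chartAt (EucSp n) c'
  have hA : MeasurableSet (e.target ∩ e.symm ⁻¹' s) :=
    measurableSet_chart_preimage c hs
  have himg : e'.target ∩ e'.symm ⁻¹' s = (e' ∘ e.symm) '' (e.target ∩ e.symm ⁻¹' s) := by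
    ext y
    constructor
    · rintro ⟨hy, hys⟩
      exact ⟨e (e'.symm y), ⟨e.map_source (hc hys), by simpa [e.left_inv (hc hys)] using hys⟩,
        by simp [e.left_inv (hc hys), e'.right_inv hy]⟩
    · rintro ⟨z, ⟨hz, hzs⟩, rfl⟩
      exact ⟨e'.map_source (hc' hzs), by simpa [e'.left_inv (hc' hzs)] using hzs⟩
  rw [chartVolume_apply c hs, chartVolume_apply c' hs, himg,
    lintegral_image_eq_lintegral_abs_det_fderiv_mul volume hA
      (f' := fun y => tangentCoordChange 𝓘(ℝ, EucSp n) c c' (e.symm y))]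
  · refine setLIntegral_congr_fun hA fun y hy => ?_
    simp only [Function.comp]
    rw [e'.left_inv (hc' hy.2), metricMatrix_change (hc hy.2) (hc' hy.2),
      ENNReal.ofReal_mul (abs_nonneg _)]
  · intro y hy
    have := hasFDerivWithinAt_tangentCoordChange (I := 𝓘(ℝ, EucSp n)) (x := c) (y := c')
      (z := e.symm y) ⟨by rw [extChartAt_source]; exact hc hy.2,
        by rw [extChartAt_source]; exact hc' hy.2⟩
    have h2 : extChartAt 𝓘(ℝ, EucSp n) c (e.symm y) = y := by simp [e.right_inv hy.1, e]
    rw [h2] at this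
    refine HasFDerivWithinAt.mono ?_ (subset_univ _)
    simpa using this
  · intro y hy z hz hyz
    have h1 := e'.injOn (hc' hy.2) (hc' hz.2) hyz
    exact e.symm.injOn hy.1 hz.1 h1

lemma chartVolume_inter_source (c : M) {s : Set M} (hs : MeasurableSet s) :
    chartVolume n c (s ∩ (chartAt (EucSp n) c).source) = chartVolume n c s := by
  have hm := (chartAt (EucSp n) c).open_source.measurableSet
  rw [chartVolume_apply c hs, chartVolume_apply c (hs.inter hm)]
  congr 2
  ext y
  simp only [mem_inter_iff, mem_preimage]
  exact ⟨fun h => ⟨h.1, h.2.1⟩, fun h => ⟨h.1, h.2, (chartAt (EucSp n) c).map_target h.1⟩⟩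

/-- In every chart, the Riemannian volume is `√(det gᵢⱼ) dx¹ ⋯ dxⁿ`. -/
theorem riemannianVolume_restrict_chart (c : M) :
    (riemannianVolume n M).restrict (chartAt (EucSp n) c).source = chartVolume n c := by
  set S := (chartAt (EucSp n) c).source
  have hS : MeasurableSet S := (chartAt (EucSp n) c).open_source.measurableSet
  apply le_antisymm
  · have key : riemannianVolume n M ≤
        (chartVolume n c).restrict S + (riemannianVolume n M).restrict Sᶜ := by
      refine iSup_le fun d => Measure.le_iff.2 fun s hs => ?_
      have hd : MeasurableSet (chartAt (EucSp n) d).source :=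
        (chartAt (EucSp n) d).open_source.measurableSet
      rw [Measure.add_apply, Measure.restrict_apply hs, Measure.restrict_apply hs,
        ← measure_inter_add_sdiff s hS]
      refine add_le_add ?_ ?_
      · rw [← chartVolume_inter_source d (hs.inter hS), chartVolume_compat d c
          ((hs.inter hS).inter hd) inter_subset_right (inter_subset_left.trans inter_subset_right)]
        exact measure_mono inter_subset_left
      · exact Measure.le_iff.1 (le_iSup (fun d : M => chartVolume n d) d) _ (hs.diff hS)
    refine Measure.le_iff.2 fun s hs => ?_
    rw [Measure.restrict_apply hs]
    refine (Measure.le_iff.1 key _ (hs.inter hS)).trans ?_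
    rw [Measure.add_apply, Measure.restrict_apply (hs.inter hS),
      Measure.restrict_apply (hs.inter hS)]
    have : s ∩ S ∩ Sᶜ = ∅ := by ext x; simp
    rw [this, measure_empty, add_zero]
    exact measure_mono (inter_subset_left.trans inter_subset_left)
  · refine Measure.le_iff.2 fun s hs => ?_
    rw [Measure.restrict_apply hs, ← chartVolume_inter_source c hs]
    exact Measure.le_iff.1 (le_iSup (fun d : M => chartVolume n d) c) _ (hs.inter hS)

end

section

variable {n : ℕ} {M : Type*} [TopologicalSpace M] [ChartedSpace (EucSp n) M]
  [IsManifold 𝓘(ℝ, EucSp n) ∞ M] [RiemannianBundle (fun x : M => TangentSpace 𝓘(ℝ, EucSp n) x)]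

instance (x : M) : FiniteDimensional ℝ (TangentSpace 𝓘(ℝ, EucSp n) x) :=
  inferInstanceAs (FiniteDimensional ℝ (EucSp n))

instance (x : M) : CompleteSpace (TangentSpace 𝓘(ℝ, EucSp n) x) :=
  FiniteDimensional.complete ℝ _

variable (n) in
/-- The Riemannian gradient `∇u` at `x`: the tangent vector that represents the differential of `u`
at `x` through the metric (zero where `u` is not differentiable). -/
def grad (u : M → ℝ) (x : M) : TangentSpace 𝓘(ℝ, EucSp n) x :=
  (InnerProductSpace.toDual ℝ (TangentSpace 𝓘(ℝ, EucSp n) x)).symm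
    (mfderiv 𝓘(ℝ, EucSp n) 𝓘(ℝ, ℝ) u x)

variable (n) in
/-- `Δu ≥ f` in the sense of distributions, for a locally Lipschitz function `u` (whose
distributional gradient is its almost everywhere defined gradient) and a function `f`: `f` is locally integrable and `-∫ ⟨∇u, ∇η⟩ ≥ ∫ f η` for all smooth compactly supported `η ≥ 0`.
-/
def LaplacianGE [MeasurableSpace M] (u f : M → ℝ) : Prop :=
  LocallyIntegrable f (riemannianVolume n M) ∧
    ∀ η : M → ℝ, ContMDiff 𝓘(ℝ, EucSp n) 𝓘(ℝ, ℝ) ∞ η → HasCompactSupport η → (∀ x, 0 ≤ η x) →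
      ∫ x, f x * η x ∂(riemannianVolume n M) ≤
        -∫ x, inner ℝ (grad n u x) (grad n η x) ∂(riemannianVolume n M)

end

end RiemHardy

end

/-! Write `κ = (C + α - 1) / 2` and `X = ∇φ + (κ φ / ρ) ∇ρ`, which up to the factor `ρ ^ κ` is the
gradient of the ground state transform `ρ ^ κ φ`. Everything follows from testing `Δρ ≥ C / ρ` with
`ρ ^ s |φ| ^ p`. Since `|∇ρ| = 1`, this gives `(C + s) ∫ ρ ^ (s - 1) |φ| ^ p ≤ -∫ ρ ^ s p |φ| ^ (p -
2) φ ⟨∇φ, ∇ρ⟩` (`weighted_power_test`), and it is used twice.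

With `p = 2`, `s = α - 1` it bounds the cross term in the expansion of `ρ ^ α |X|²`. The result is
the Hardy inequality with the sharper remainder `∫ ρ ^ α |X|²` (`hardy_shifted`).

With `p = q`, `s - 1 = q (α / 2 - 1)`, substituting `∇φ = X - (κ φ / ρ) ∇ρ` leaves the coefficient
`C + s - q κ = (1 + C)(1 - q / 2)`, positive exactly because `q < 2` (`hardy_Lq_shifted`). By
Hölder, `Q = ρ ^ (α / 2 - 1) |φ|` is then controlled in `L^q` by `P = ρ ^ (α / 2) |X|`. As `ρ ^ (α /
2) |∇φ| ≤ P + κ Q`, its `L^q` norm is bounded by that of `P`, and on a set of finite volume by the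
`L²` norm of `P`, whose square is the remainder (`sq_Lq_le_sq_L2`). The ratio `κ / (1 + C)` stays
bounded in `C`, so the constant depends only on `q`, `α` and the volume of `Ω`. That volume is
finite because bounded sets of a complete Riemannian manifold are relatively compact
(`properSpace_of_complete`).

Two technical points remain. The weights may be singular on the zero set of `ρ`, so `ρ` is replaced
by `ρ + ε`, and `ε → 0` at the end. The test functions are only Lipschitz, so the distributional
inequality is extended from smooth ones by a partition of unity and mollification in charts
(`weak_inequality_of_chartLipschitz`). -/

noncomputable section

namespace RiemHardy

set_option linter.unusedSectionVars false

/-! ### Hopf–Rinow: bounded closed sets are compact -/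

section HopfRinow

/-- The metric form of the Hopf–Rinow theorem: a complete locally compact space in which points at
intermediate distances almost realise the triangle equality is proper. -/
theorem properSpace_of_intermediate_points {X : Type*} [MetricSpace X] [CompleteSpace X]
    [WeaklyLocallyCompactSpace X]
    (h : ∀ (x y : X) (r ε : ℝ), 0 ≤ r → r ≤ dist x y → 0 < ε →
      ∃ z, dist x z ≤ r ∧ dist z y < dist x y - r + ε) : ProperSpace X := by
  refine ⟨fun x => ?_⟩
  have hclosed : ∀ R : ℝ, 0 < R → (∀ s, 0 ≤ s → s < R → IsCompact (Metric.closedBall x s)) →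
      IsCompact (Metric.closedBall x R) := by
    intro R hR hs
    refine TotallyBounded.isCompact_of_isClosed ?_ Metric.isClosed_closedBall
    rw [Metric.totallyBounded_iff]
    intro ε hε
    -- Every point of the ball of radius `R` lies within `R - s + ε / 4 ≤ ε / 2` of the compact ball
    -- of radius `s`, so a finite `ε / 2`-net of the latter is an `ε`-net of the former.
    set s := max 0 (R - ε / 4) with hs_def
    have hs0 : 0 ≤ s := le_max_left _ _
    have hsR : s < R := max_lt hR (by linarith)
    obtain ⟨t, -, ht, htc⟩ := (hs s hs0 hsR).finite_cover_balls (e := ε / 2) (by positivity)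
    refine ⟨t, ht, fun y hy => ?_⟩
    rw [Metric.mem_closedBall, dist_comm] at hy
    have key : ∃ z ∈ Metric.closedBall x s, dist z y < ε / 2 := by
      rcases le_or_gt (dist x y) s with hxy | hxy
      · exact ⟨y, by rwa [Metric.mem_closedBall, dist_comm], by simpa using hε⟩
      · obtain ⟨z, hz1, hz2⟩ := h x y s (ε / 4) hs0 hxy.le (by positivity)
        refine ⟨z, by rwa [Metric.mem_closedBall, dist_comm], ?_⟩
        have : R - ε / 4 ≤ s := le_max_right _ _
        linarith
    obtain ⟨z, hz, hzy⟩ := key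
    obtain ⟨w, hw, hzw⟩ := mem_iUnion₂.1 (htc hz)
    refine mem_iUnion₂.2 ⟨w, hw, ?_⟩
    rw [Metric.mem_ball] at hzw ⊢
    linarith [dist_triangle y z w, dist_comm y z]
  have hopen : ∀ R : ℝ, 0 ≤ R → IsCompact (Metric.closedBall x R) →
      ∃ δ > 0, IsCompact (Metric.closedBall x (R + δ)) := by
    intro R hR hK
    -- Local compactness puts a whole `δ`-thickening of the ball in a compact set. Half of `δ` is
    -- the enlargement of the radius, the other half the slack of the intermediate point.
    obtain ⟨K', hK', hKK'⟩ := exists_compact_superset hK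
    obtain ⟨δ, hδ, hδK⟩ := hK.exists_thickening_subset_open isOpen_interior hKK'
    refine ⟨δ / 2, by positivity, hK'.of_isClosed_subset Metric.isClosed_closedBall
      (fun y hy => interior_subset (hδK ?_))⟩
    rw [Metric.mem_closedBall, dist_comm] at hy
    rw [Metric.mem_thickening_iff]
    rcases le_or_gt (dist x y) R with hxy | hxy
    · exact ⟨y, by rwa [Metric.mem_closedBall, dist_comm], by simpa using hδ⟩
    · obtain ⟨z, hz1, hz2⟩ := h x y R (δ / 2) hR hxy.le (by positivity)
      refine ⟨z, by rwa [Metric.mem_closedBall, dist_comm], ?_⟩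
      rw [dist_comm]; linarith
  by_contra! hcon
  obtain ⟨r, hr⟩ := hcon
  -- The supremum of the radii with compact ball is attained by `hclosed`, and then exceeded by
  -- `hopen`.
  set S := {s : ℝ | 0 ≤ s ∧ IsCompact (Metric.closedBall x s)} with hS
  have h0 : (0 : ℝ) ∈ S := ⟨le_rfl, by simp⟩
  have hbdd : BddAbove S := ⟨r, fun s hs => by
    by_contra! hrs
    exact hr (hs.2.of_isClosed_subset Metric.isClosed_closedBall
      (Metric.closedBall_subset_closedBall hrs.le))⟩
  have hR0 : 0 ≤ sSup S := le_csSup hbdd h0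
  have hR : IsCompact (Metric.closedBall x (sSup S)) := by
    rcases hR0.eq_or_lt with h1 | h1
    · rw [← h1]; exact h0.2
    · refine hclosed _ h1 fun s hs hsS => ?_
      obtain ⟨s', hs', hss'⟩ := exists_lt_of_lt_csSup ⟨0, h0⟩ hsS
      exact hs'.2.of_isClosed_subset Metric.isClosed_closedBall
        (Metric.closedBall_subset_closedBall hss'.le)
  obtain ⟨δ, hδ, hδc⟩ := hopen _ hR0 hR
  have := le_csSup hbdd (show sSup S + δ ∈ S from ⟨by linarith, hδc⟩)
  linarith

variable {n : ℕ} {M : Type*} [MetricSpace M] [ChartedSpace (EucSp n) M]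
  [RiemannianBundle (fun x : M => TangentSpace 𝓘(ℝ, EucSp n) x)]

variable (n) in
/-- On a Riemannian manifold, points at intermediate distances almost realise the triangle
equality. -/
lemma exists_intermediate_point [IsRiemannianManifold 𝓘(ℝ, EucSp n) M] (x y : M) (r ε : ℝ)
    (hr : 0 ≤ r) (hxy : r ≤ dist x y) (hε : 0 < ε) :
    ∃ z, dist x z ≤ r ∧ dist z y < dist x y - r + ε := by
  have hlt : riemannianEDist 𝓘(ℝ, EucSp n) x y < ENNReal.ofReal (dist x y + ε) := by
    rw [← IsRiemannianManifold.out (I := 𝓘(ℝ, EucSp n)), edist_dist]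
    exact (ENNReal.ofReal_lt_ofReal_iff (by positivity)).2 (by linarith)
  -- The intermediate point lies on an almost minimising curve, where the distance from `x` takes
  -- the value `r`. Both arcs are at least as long as the distance between their ends.
  obtain ⟨γ, h0, h1, hγ, hlen⟩ := exists_lt_of_riemannianEDist_lt hlt
  have hcont : ContinuousOn (fun t => dist x (γ t)) (Icc 0 1) :=
    (continuous_const.dist continuous_id).comp_continuousOn hγ.continuousOn
  obtain ⟨t, ht, htr⟩ := intermediate_value_Icc zero_le_one hcont
    (show r ∈ Icc (dist x (γ 0)) (dist x (γ 1)) by simp [h0, h1, hr, hxy])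
  refine ⟨γ t, htr.le, ?_⟩
  have hadd := pathELength_add (I := 𝓘(ℝ, EucSp n)) (γ := γ) ht.1 ht.2
  have hA : ENNReal.ofReal r ≤ pathELength 𝓘(ℝ, EucSp n) γ 0 t := by
    rw [← htr, ← edist_dist, IsRiemannianManifold.out (I := 𝓘(ℝ, EucSp n))]
    exact riemannianEDist_le_pathELength (hγ.mono (Icc_subset_Icc le_rfl ht.2)) h0 rfl ht.1
  have hB : ENNReal.ofReal (dist (γ t) y) ≤ pathELength 𝓘(ℝ, EucSp n) γ t 1 := by
    rw [← edist_dist, IsRiemannianManifold.out (I := 𝓘(ℝ, EucSp n))]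
    exact riemannianEDist_le_pathELength (hγ.mono (Icc_subset_Icc ht.1 le_rfl)) rfl h1 ht.2
  have : ENNReal.ofReal (r + dist (γ t) y) < ENNReal.ofReal (dist x y + ε) := by
    rw [ENNReal.ofReal_add hr dist_nonneg]
    exact (add_le_add hA hB).trans_lt (hadd ▸ hlen)
  have := (ENNReal.ofReal_lt_ofReal_iff (by positivity)).1 this
  linarith

variable (n M) in
/-- The Hopf–Rinow theorem: bounded closed subsets of a complete Riemannian manifold are
compact. -/
theorem properSpace_of_complete [IsRiemannianManifold 𝓘(ℝ, EucSp n) M] [CompleteSpace M] :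
    ProperSpace M := by
  have : LocallyCompactSpace M := ChartedSpace.locallyCompactSpace (EucSp n) M
  exact properSpace_of_intermediate_points fun x y r ε => exists_intermediate_point n x y r ε

end HopfRinow

/-! ### Gradients read in charts -/

section ChartCalculus

variable {n : ℕ} {M : Type*} [TopologicalSpace M] [ChartedSpace (EucSp n) M]
  [IsManifold 𝓘(ℝ, EucSp n) ∞ M]

variable (n) in
/-- The derivative at `x` of the chart around `c` (meaningful when `x` lies in its domain). -/
def chartDeriv (c x : M) : TangentSpace 𝓘(ℝ, EucSp n) x →L[ℝ] EucSp n :=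
  (trivializationAt (EucSp n) (TangentSpace 𝓘(ℝ, EucSp n) (M := M)) c).continuousLinearMapAt ℝ x

lemma chartDeriv_coordField {c x : M} (hx : x ∈ (chartAt (EucSp n) c).source) (i : Fin n) :
    chartDeriv n c x (coordField n c i x) = EuclideanSpace.basisFun (Fin n) ℝ i := by
  rw [chartDeriv, coordField]
  refine Trivialization.continuousLinearMapAt_symmL _ ?_ _
  rwa [TangentBundle.trivializationAt_baseSet]

lemma symmL_chartDeriv {c x : M} (hx : x ∈ (chartAt (EucSp n) c).source)
    (v : TangentSpace 𝓘(ℝ, EucSp n) x) :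
    (trivializationAt (EucSp n) (TangentSpace 𝓘(ℝ, EucSp n) (M := M)) c).symmL ℝ x
      (chartDeriv n c x v) = v := by
  rw [chartDeriv]
  refine Trivialization.symmL_continuousLinearMapAt _ ?_ _
  rwa [TangentBundle.trivializationAt_baseSet]

lemma mdifferentiableAt_iff_chart {c x : M} (hx : x ∈ (chartAt (EucSp n) c).source) (u : M → ℝ) :
    MDifferentiableAt 𝓘(ℝ, EucSp n) 𝓘(ℝ, ℝ) u x ↔
      DifferentiableAt ℝ (u ∘ (chartAt (EucSp n) c).symm) (chartAt (EucSp n) c x) := by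
  set e := chartAt (EucSp n) c
  have he : MDifferentiableAt 𝓘(ℝ, EucSp n) 𝓘(ℝ, EucSp n) e x :=
    mdifferentiableAt_extChartAt (I := 𝓘(ℝ, EucSp n)) hx
  have hes : MDifferentiableAt 𝓘(ℝ, EucSp n) 𝓘(ℝ, EucSp n) e.symm (e x) :=
    mdifferentiableAt_atlas_symm (chart_mem_atlas (EucSp n) c) (e.map_source hx)
  rw [← mdifferentiableAt_iff_differentiableAt]
  constructor
  · intro h
    refine MDifferentiableAt.comp (e x) ?_ hes
    rwa [e.left_inv hx]
  · intro h
    have h2 := MDifferentiableAt.comp x h he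
    refine h2.congr_of_eventuallyEq ?_
    filter_upwards [e.open_source.mem_nhds hx] with y hy
    simp [e.left_inv hy]

lemma hasMFDerivAt_chartAt {c x : M} (hx : x ∈ (chartAt (EucSp n) c).source) :
    HasMFDerivAt 𝓘(ℝ, EucSp n) 𝓘(ℝ, EucSp n) (chartAt (EucSp n) c) x (chartDeriv n c x) := by
  have h : MDifferentiableAt 𝓘(ℝ, EucSp n) 𝓘(ℝ, EucSp n) (extChartAt 𝓘(ℝ, EucSp n) c) x :=
    mdifferentiableAt_extChartAt (I := 𝓘(ℝ, EucSp n)) hx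
  have h2 := h.hasMFDerivAt
  rw [← TangentBundle.continuousLinearMapAt_trivializationAt hx] at h2
  exact h2

lemma hasMFDerivAt_chart {c x : M} (hx : x ∈ (chartAt (EucSp n) c).source) {u : M → ℝ}
    (hu : MDifferentiableAt 𝓘(ℝ, EucSp n) 𝓘(ℝ, ℝ) u x) :
    HasMFDerivAt 𝓘(ℝ, EucSp n) 𝓘(ℝ, ℝ) u x
      ((fderiv ℝ (u ∘ (chartAt (EucSp n) c).symm) (chartAt (EucSp n) c x)).comp
        (chartDeriv n c x)) := by
  set e := chartAt (EucSp n) c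
  have hd := ((mdifferentiableAt_iff_chart hx u).1 hu).hasFDerivAt.hasMFDerivAt
  refine (hd.comp x (hasMFDerivAt_chartAt hx)).congr_of_eventuallyEq ?_
  filter_upwards [e.open_source.mem_nhds hx] with y hy
  simp [e, e.left_inv hy]

variable [RiemannianBundle (fun x : M => TangentSpace 𝓘(ℝ, EucSp n) x)]

lemma inner_grad (u : M → ℝ) (x : M) (v : TangentSpace 𝓘(ℝ, EucSp n) x) :
    inner ℝ (grad n u x) v = mfderiv 𝓘(ℝ, EucSp n) 𝓘(ℝ, ℝ) u x v := by
  rw [grad]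
  exact InnerProductSpace.toDual_symm_apply

lemma grad_eq_zero_of_mfderiv {u : M → ℝ} {x : M}
    (h : mfderiv 𝓘(ℝ, EucSp n) 𝓘(ℝ, ℝ) u x = 0) : grad n u x = 0 := by
  rw [grad, h]; exact map_zero _

/-- The gradient in a chart. -/
lemma inner_grad_eq_fderiv {c x : M} (hx : x ∈ (chartAt (EucSp n) c).source) (u : M → ℝ)
    (v : TangentSpace 𝓘(ℝ, EucSp n) x) :
    inner ℝ (grad n u x) v =
      fderiv ℝ (u ∘ (chartAt (EucSp n) c).symm) (chartAt (EucSp n) c x) (chartDeriv n c x v) := by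
  -- Where `u` is not differentiable both sides take the default value zero, so no regularity is
  -- needed.
  by_cases hu : MDifferentiableAt 𝓘(ℝ, EucSp n) 𝓘(ℝ, ℝ) u x
  · rw [inner_grad, (hasMFDerivAt_chart hx hu).mfderiv]
    rfl
  · rw [grad_eq_zero_of_mfderiv (mfderiv_zero_of_not_mdifferentiableAt hu),
      fderiv_zero_of_not_differentiableAt (fun h => hu ((mdifferentiableAt_iff_chart hx u).2 h))]
    simp

/-- Since the gradient is zero by default, `|∇ρ| = 1` almost everywhere already contains the almost
everywhere differentiability of `ρ`. -/
lemma mdifferentiableAt_of_grad_ne_zero {u : M → ℝ} {x : M} (h : grad n u x ≠ 0) :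
    MDifferentiableAt 𝓘(ℝ, EucSp n) 𝓘(ℝ, ℝ) u x := by
  by_contra hu
  exact h (grad_eq_zero_of_mfderiv (mfderiv_zero_of_not_mdifferentiableAt hu))

lemma norm_grad_le {u : M → ℝ} {x : M} {B : ℝ} (hB : 0 ≤ B)
    (h : ∀ v, |inner ℝ (grad n u x) v| ≤ B * ‖v‖) : ‖grad n u x‖ ≤ B := by
  rcases eq_or_ne (grad n u x) 0 with h0 | h0
  · rw [h0, norm_zero]; exact hB
  · have h1 := h (grad n u x)
    rw [real_inner_self_eq_norm_sq, abs_of_nonneg (sq_nonneg _)] at h1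
    have h2 : 0 < ‖grad n u x‖ := norm_pos_iff.2 h0
    nlinarith

/-- A zero of a nonnegative `ρ` is a minimum, so this is incompatible there with `|∇ρ| = 1` and
makes the zero set null. -/
lemma grad_eq_zero_of_isLocalMin {u : M → ℝ} {x : M} (h : IsLocalMin u x) : grad n u x = 0 := by
  refine ext_inner_right ℝ fun v => ?_
  set e := chartAt (EucSp n) x
  have hx := mem_chart_source (EucSp n) x
  rw [inner_grad_eq_fderiv hx]
  have : IsLocalMin (u ∘ e.symm) (e x) := by
    have hc : ContinuousAt e.symm (e x) := e.continuousAt_symm (e.map_source hx)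
    have h' : ∀ᶠ y in 𝓝 (e.symm (e x)), u x ≤ u y := by rw [e.left_inv hx]; exact h
    filter_upwards [hc.eventually h'] with y hy
    simpa [e.left_inv hx] using hy
  rw [this.fderiv_eq_zero]
  simp

end ChartCalculus

/-! ### Local comparison of the metric with the Euclidean one -/

section LocalBounds

variable {n : ℕ} {M : Type*} [TopologicalSpace M] [ChartedSpace (EucSp n) M]
  [IsManifold 𝓘(ℝ, EucSp n) ∞ M]
  [RiemannianBundle (fun x : M => TangentSpace 𝓘(ℝ, EucSp n) x)]
  [IsContMDiffRiemannianBundle 𝓘(ℝ, EucSp n) ∞ (EucSp n)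
      (fun x : M => TangentSpace 𝓘(ℝ, EucSp n) x)]

lemma isContinuousRiemannianBundle_tangentSpace :
    IsContinuousRiemannianBundle (EucSp n) (fun x : M => TangentSpace 𝓘(ℝ, EucSp n) x) := by
  have : IsContMDiffRiemannianBundle 𝓘(ℝ, EucSp n) 1 (EucSp n)
      (fun x : M => TangentSpace 𝓘(ℝ, EucSp n) x) :=
    IsContMDiffRiemannianBundle.of_le (n := ∞) (by norm_cast)
  obtain ⟨g, hg, hgi⟩ := this.exists_contMDiff
  exact ⟨g, hg.continuous, hgi⟩

/-- Continuity of the metric makes its norm comparable with the Euclidean one near `c`. This half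
turns bounds on coordinate derivatives into bounds on gradients; the companion bound on `coordField`
controls the volume density. -/
lemma eventually_norm_chartDeriv_le (c : M) :
    ∃ B > 0, ∀ᶠ x in 𝓝 c, ∀ v, ‖chartDeriv n c x v‖ ≤ B * ‖v‖ := by
  have := isContinuousRiemannianBundle_tangentSpace (n := n) (M := M)
  obtain ⟨B, hB, h⟩ := eventually_norm_trivializationAt_lt (EucSp n)
    (fun x : M => TangentSpace 𝓘(ℝ, EucSp n) x) c
  exact ⟨B, hB, h.mono fun x hx v => ContinuousLinearMap.le_of_opNorm_le _ hx.le v⟩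

lemma eventually_norm_coordField_le (c : M) :
    ∃ B > 0, ∀ᶠ x in 𝓝 c, ∀ i, ‖coordField n c i x‖ ≤ B := by
  have := isContinuousRiemannianBundle_tangentSpace (n := n) (M := M)
  obtain ⟨B, hB, h⟩ := eventually_norm_symmL_trivializationAt_lt (EucSp n)
    (fun x : M => TangentSpace 𝓘(ℝ, EucSp n) x) c
  refine ⟨B, hB, h.mono fun x hx i => ?_⟩
  refine (ContinuousLinearMap.le_of_opNorm_le _ hx.le
    (EuclideanSpace.basisFun (Fin n) ℝ i)).trans_eq ?_
  simp

end LocalBounds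

/-! ### Lipschitz bounds for inverse charts -/

section LipschitzCharts

variable {n : ℕ} {M : Type*} [MetricSpace M] [ChartedSpace (EucSp n) M]
  [IsManifold 𝓘(ℝ, EucSp n) ∞ M]
  [RiemannianBundle (fun x : M => TangentSpace 𝓘(ℝ, EucSp n) x)]
  [IsContMDiffRiemannianBundle 𝓘(ℝ, EucSp n) ∞ (EucSp n)
      (fun x : M => TangentSpace 𝓘(ℝ, EucSp n) x)]

/-- Differentiate `e ∘ e.symm = id`. This gives the speed of a Euclidean segment carried to `M`. -/
lemma mfderiv_chart_symm_apply {c : M} {y : EucSp n} (hy : y ∈ (chartAt (EucSp n) c).target)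
    (v : EucSp n) :
    mfderiv 𝓘(ℝ, EucSp n) 𝓘(ℝ, EucSp n) (chartAt (EucSp n) c).symm y v =
      (trivializationAt (EucSp n) (TangentSpace 𝓘(ℝ, EucSp n) (M := M)) c).symmL ℝ
        ((chartAt (EucSp n) c).symm y) v := by
  set e := chartAt (EucSp n) c
  have hx := e.map_target hy
  have hs : MDifferentiableAt 𝓘(ℝ, EucSp n) 𝓘(ℝ, EucSp n) e.symm y :=
    mdifferentiableAt_atlas_symm (chart_mem_atlas (EucSp n) c) hy
  have hcomp := (hasMFDerivAt_chartAt hx).comp y hs.hasMFDerivAt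
  have hid : HasMFDerivAt 𝓘(ℝ, EucSp n) 𝓘(ℝ, EucSp n) (e ∘ e.symm) y
      (ContinuousLinearMap.id ℝ (EucSp n)) := by
    refine (hasMFDerivAt_id y).congr_of_eventuallyEq ?_
    filter_upwards [e.open_target.mem_nhds hy] with z hz
    simp [e.right_inv hz]
  have h := hasMFDerivAt_unique hcomp hid
  have hv : chartDeriv n c (e.symm y)
      (mfderiv 𝓘(ℝ, EucSp n) 𝓘(ℝ, EucSp n) e.symm y v) = v := DFunLike.congr_fun h v
  rw [← symmL_chartDeriv hx (mfderiv 𝓘(ℝ, EucSp n) 𝓘(ℝ, EucSp n) e.symm y v), hv]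

/-- The inverse of a chart is Lipschitz near its centre. -/
lemma exists_lipschitzOnWith_chart_symm [IsRiemannianManifold 𝓘(ℝ, EucSp n) M] (c : M) :
    ∃ K, ∃ V ∈ 𝓝 (chartAt (EucSp n) c c), LipschitzOnWith K (chartAt (EucSp n) c).symm V := by
  have := isContinuousRiemannianBundle_tangentSpace (n := n) (M := M)
  obtain ⟨C, hC0, hC⟩ := eventually_norm_symmL_trivializationAt_lt (EucSp n)
    (fun x : M => TangentSpace 𝓘(ℝ, EucSp n) x) c
  have hcs := mem_chart_source (EucSp n) c
  set e := chartAt (EucSp n) c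
  have hct : ContinuousAt e.symm (e c) := e.continuousAt_symm (e.map_source hcs)
  have hC' : ∀ᶠ x in 𝓝 (e.symm (e c)), ‖(trivializationAt (EucSp n)
      (TangentSpace 𝓘(ℝ, EucSp n) (M := M)) c).symmL ℝ x‖ < C := by
    rwa [e.left_inv hcs]
  obtain ⟨r, r_pos, hr⟩ := Metric.mem_nhds_iff.1
    (Filter.inter_mem (e.open_target.mem_nhds (e.map_source hcs)) (hct.eventually hC'))
  refine ⟨C.toNNReal, Metric.ball (e c) r, Metric.ball_mem_nhds _ r_pos, ?_⟩
  intro y hy z hz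
  -- The straight segment stays in the ball by convexity, and its image in `M` is a competitor for
  -- the Riemannian distance, of speed at most `C * dist y z`.
  let η : ℝ → EucSp n := fun t => y + t • (z - y)
  have hη : ∀ t ∈ Icc (0 : ℝ) 1, η t ∈ Metric.ball (e c) r := fun t ht =>
    (convex_ball _ _).add_smul_sub_mem hy hz ht
  have hη_smooth : ContMDiffOn 𝓘(ℝ, ℝ) 𝓘(ℝ, EucSp n) 1 η (Icc 0 1) := by
    apply ContMDiff.contMDiffOn
    rw [contMDiff_iff_contDiff]
    fun_prop
  rw [IsRiemannianManifold.out (I := 𝓘(ℝ, EucSp n))]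
  have hlen : riemannianEDist 𝓘(ℝ, EucSp n) (e.symm y) (e.symm z)
      ≤ pathELength 𝓘(ℝ, EucSp n) (e.symm ∘ η) 0 1 := by
    apply riemannianEDist_le_pathELength _ _ _ zero_le_one
    · exact (contMDiffOn_chart_symm (I := 𝓘(ℝ, EucSp n)) (x := c)).comp hη_smooth
        fun t ht => (hr (hη t ht)).1
    · simp [η]
    · simp [η]
  refine hlen.trans ?_
  rw [pathELength_eq_lintegral_mfderiv_Icc]
  calc ∫⁻ t in Icc (0 : ℝ) 1, ‖mfderiv 𝓘(ℝ, ℝ) 𝓘(ℝ, EucSp n) (e.symm ∘ η) t 1‖ₑ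
      ≤ ∫⁻ t in Icc (0 : ℝ) 1, ENNReal.ofReal C * edist y z := by
        refine setLIntegral_mono' measurableSet_Icc fun t ht => ?_
        have hd : HasDerivAt η (z - y) t := by
          simpa [η] using ((hasDerivAt_id t).smul_const (z - y)).const_add y
        have h1 : HasMFDerivAt 𝓘(ℝ, ℝ) 𝓘(ℝ, EucSp n) η t _ := hd.hasFDerivAt.hasMFDerivAt
        have h2 : MDifferentiableAt 𝓘(ℝ, EucSp n) 𝓘(ℝ, EucSp n) e.symm (η t) :=
          mdifferentiableAt_atlas_symm (chart_mem_atlas (EucSp n) c) (hr (hη t ht)).1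
        rw [(h2.hasMFDerivAt.comp t h1).mfderiv]
        have h3 := mfderiv_chart_symm_apply (hr (hη t ht)).1 (z - y)
        have h4 : ‖mfderiv 𝓘(ℝ, EucSp n) 𝓘(ℝ, EucSp n) e.symm (η t) (z - y)‖ ≤ C * dist y z := by
          rw [h3, dist_comm, dist_eq_norm]
          exact ContinuousLinearMap.le_of_opNorm_le _ (hr (hη t ht)).2.le (z - y)
        rw [edist_dist, ← ENNReal.ofReal_mul hC0.le, ← ofReal_norm]
        refine ENNReal.ofReal_le_ofReal (le_trans (le_of_eq ?_) h4)
        congr 1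
        change mfderiv 𝓘(ℝ, EucSp n) 𝓘(ℝ, EucSp n) e.symm (η t) ((1 : ℝ) • (z - y)) = _
        exact congrArg _ (one_smul ℝ (z - y))
    _ = C.toNNReal * edist y z := by
        simp [ENNReal.ofReal]

end LipschitzCharts

/-! ### Functions that are Lipschitz in charts -/

section ChartLipschitzCalculus

variable {n : ℕ} {M : Type*} [TopologicalSpace M] [ChartedSpace (EucSp n) M]

variable (n) in
/-- A real function on a manifold that is Lipschitz near the centre of every chart, read in this
chart. -/
def ChartLipschitz (u : M → ℝ) : Prop :=
  ∀ c : M, ∃ K, ∃ V ∈ 𝓝 (chartAt (EucSp n) c c),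
    LipschitzOnWith K (u ∘ (chartAt (EucSp n) c).symm) V

/-- Every point is the centre of its own preferred chart, so a condition at chart centres is a local
condition on all of `M`. -/
lemma ChartLipschitz.continuous {u : M → ℝ} (hu : ChartLipschitz n u) : Continuous u := by
  rw [continuous_iff_continuousAt]
  intro c
  obtain ⟨K, V, hV, h⟩ := hu c
  set e := chartAt (EucSp n) c
  have h1 : ContinuousAt (u ∘ e.symm) (e c) := h.continuousOn.continuousAt hV
  have h2 : ContinuousAt e c := e.continuousAt (mem_chart_source _ c)
  have h3 : ContinuousAt ((u ∘ e.symm) ∘ e) c := ContinuousAt.comp h1 h2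
  refine h3.congr ?_
  filter_upwards [e.open_source.mem_nhds (mem_chart_source _ c)] with y hy
  simp [e.left_inv hy]

/-- `F (u, v)` is Lipschitz in charts when `u` and `v` are and `F` is `C¹`. -/
lemma ChartLipschitz.comp₂ {u v : M → ℝ} (hu : ChartLipschitz n u) (hv : ChartLipschitz n v)
    {F : ℝ × ℝ → ℝ} (hF : ∀ x, ContDiffAt ℝ 1 F (u x, v x)) :
    ChartLipschitz n fun x => F (u x, v x) := by
  intro c
  obtain ⟨K, V, hV, h⟩ := hu c
  obtain ⟨K', V', hV', h'⟩ := hv c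
  obtain ⟨L, W, hW, hL⟩ := (hF c).exists_lipschitzOnWith
  set e := chartAt (EucSp n) c
  set w : EucSp n → ℝ × ℝ := fun y => (u (e.symm y), v (e.symm y))
  have hw : LipschitzOnWith (max K K') w (V ∩ V') :=
    (h.mono inter_subset_left).prodMk (h'.mono inter_subset_right)
  have hVV : V ∩ V' ∈ 𝓝 (e c) := Filter.inter_mem hV hV'
  have hwc : w ⁻¹' W ∈ 𝓝 (e c) := by
    refine (hw.continuousOn.continuousAt hVV).preimage_mem_nhds ?_
    simpa [w, e, (chartAt (EucSp n) c).left_inv (mem_chart_source _ c)] using hW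
  exact ⟨L * max K K', V ∩ V' ∩ w ⁻¹' W, Filter.inter_mem hVV hwc,
    hL.comp (hw.mono inter_subset_left) fun y hy => hy.2⟩

lemma ChartLipschitz.mul {u v : M → ℝ} (hu : ChartLipschitz n u) (hv : ChartLipschitz n v) :
    ChartLipschitz n fun x => u x * v x :=
  hu.comp₂ hv (F := fun p => p.1 * p.2) fun _ => (contDiff_fst.mul contDiff_snd).contDiffAt

lemma chartLipschitz_of_contMDiff [IsManifold 𝓘(ℝ, EucSp n) ∞ M] {u : M → ℝ}
    (hu : ContMDiff 𝓘(ℝ, EucSp n) 𝓘(ℝ, ℝ) ∞ u) : ChartLipschitz n u := by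
  intro c
  have h : ContDiffAt ℝ 1 (u ∘ (chartAt (EucSp n) c).symm) (chartAt (EucSp n) c c) := by
    have h1 := (contMDiffAt_iff.1 (hu c)).2
    simp only [mfld_simps, contDiffWithinAt_univ] at h1
    exact h1.of_le (by norm_cast)
  exact h.exists_lipschitzOnWith

end ChartLipschitzCalculus

/-! ### From the Riemannian distance to charts -/

section LocallyLipschitzInCharts

variable {n : ℕ} {M : Type*} [MetricSpace M] [ChartedSpace (EucSp n) M]
  [IsManifold 𝓘(ℝ, EucSp n) ∞ M]
  [RiemannianBundle (fun x : M => TangentSpace 𝓘(ℝ, EucSp n) x)]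
  [IsContMDiffRiemannianBundle 𝓘(ℝ, EucSp n) ∞ (EucSp n)
      (fun x : M => TangentSpace 𝓘(ℝ, EucSp n) x)]

variable (n) in
-- Composition with the locally Lipschitz inverse chart costs only a constant. The integral
-- estimates can then forget the distance of `M`.
lemma chartLipschitz_of_locallyLipschitz [IsRiemannianManifold 𝓘(ℝ, EucSp n) M] {u : M → ℝ}
    (hu : LocallyLipschitz u) : ChartLipschitz n u := by
  intro c
  obtain ⟨K, V, hV, h⟩ := exists_lipschitzOnWith_chart_symm (n := n) c
  obtain ⟨L, W, hW, hL⟩ := hu c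
  set e := chartAt (EucSp n) c
  have hc : e.symm ⁻¹' W ∈ 𝓝 (e c) := by
    refine (h.continuousOn.continuousAt hV).preimage_mem_nhds ?_
    rwa [e.left_inv (mem_chart_source _ c)]
  exact ⟨L * K, V ∩ e.symm ⁻¹' W, Filter.inter_mem hV hc,
    hL.comp (h.mono inter_subset_left) fun y hy => hy.2⟩

end LocallyLipschitzInCharts

/-! ### Local boundedness of gradients -/

section GradientBound

variable {n : ℕ} {M : Type*} [TopologicalSpace M] [ChartedSpace (EucSp n) M]
  [IsManifold 𝓘(ℝ, EucSp n) ∞ M]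
  [RiemannianBundle (fun x : M => TangentSpace 𝓘(ℝ, EucSp n) x)]
  [IsContMDiffRiemannianBundle 𝓘(ℝ, EucSp n) ∞ (EucSp n)
      (fun x : M => TangentSpace 𝓘(ℝ, EucSp n) x)]

/-- The gradient of a Lipschitz function is bounded on compact sets. -/
lemma ChartLipschitz.exists_norm_grad_le {u : M → ℝ} (hu : ChartLipschitz n u) {K : Set M}
    (hK : IsCompact K) : ∃ B, ∀ x ∈ K, ‖grad n u x‖ ≤ B := by
  have hloc : ∀ c : M, ∃ B, ∀ᶠ x in 𝓝 c, ‖grad n u x‖ ≤ B := by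
    intro c
    obtain ⟨L, V, hV, h⟩ := hu c
    obtain ⟨B, hB, hT⟩ := eventually_norm_chartDeriv_le (n := n) c
    have hcs := mem_chart_source (EucSp n) c
    set e := chartAt (EucSp n) c
    refine ⟨L * B, ?_⟩
    filter_upwards [hT, e.open_source.mem_nhds hcs,
      (e.continuousAt hcs).eventually (eventually_mem_nhds_iff.2 hV)] with x hx hxs hxV
    refine norm_grad_le (by positivity) fun v => ?_
    rw [inner_grad_eq_fderiv hxs, mul_assoc, ← Real.norm_eq_abs]
    refine (ContinuousLinearMap.le_of_opNorm_le _ (norm_fderiv_le_of_lipschitzOn ℝ hxV h) _).trans ?_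
    gcongr
    exact hx v
  refine hK.induction_on ⟨0, by simp⟩ ?_ ?_ ?_
  · rintro s t hst ⟨B, hB⟩
    exact ⟨B, fun x hx => hB x (hst hx)⟩
  · rintro s t ⟨B, hB⟩ ⟨B', hB'⟩
    refine ⟨max B B', fun x hx => hx.elim (fun h => (hB x h).trans (le_max_left _ _))
      fun h => (hB' x h).trans (le_max_right _ _)⟩
  · intro x _
    obtain ⟨B, hB⟩ := hloc x
    exact ⟨_, mem_nhdsWithin_of_mem_nhds hB, B, fun y hy => hy⟩

end GradientBound

/-! ### Null sets, local finiteness and measurability for the Riemannian volume -/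

section VolumeInCharts

variable {n : ℕ} {M : Type*} [TopologicalSpace M] [ChartedSpace (EucSp n) M]
  [IsManifold 𝓘(ℝ, EucSp n) ∞ M]
  [RiemannianBundle (fun x : M => TangentSpace 𝓘(ℝ, EucSp n) x)]
  [IsContMDiffRiemannianBundle 𝓘(ℝ, EucSp n) ∞ (EucSp n)
      (fun x : M => TangentSpace 𝓘(ℝ, EucSp n) x)]
  [MeasurableSpace M] [BorelSpace M]

/-- A property that holds almost everywhere in a chart holds almost everywhere on its domain. -/
lemma ae_restrict_source_of_ae (c : M) {p : EucSp n → Prop} (hp : ∀ᵐ y, p y) :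
    ∀ᵐ x ∂(riemannianVolume n M).restrict (chartAt (EucSp n) c).source,
      p (chartAt (EucSp n) c x) := by
  classical
  rw [riemannianVolume_restrict_chart]
  set e := chartAt (EucSp n) c
  refine (withDensity_absolutelyContinuous _ _).ae_le ?_
  have hm : AEMeasurable e.symm ((volume : Measure (EucSp n)).restrict e.target) :=
    e.continuousOn_symm.aemeasurable e.open_target.measurableSet
  obtain ⟨N, hN, hNm, hN0⟩ := exists_measurable_superset_of_null (ae_iff.1 hp)
  have hs : MeasurableSet (e.source ∩ e ⁻¹' N) := by
    -- Extended by a constant outside its source, the chart is a measurable map on all of `M`.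
    have := e.continuousOn.measurable_piecewise (continuousOn_const (c := e c))
      e.open_source.measurableSet (g := fun _ => e c)
    have h2 := e.open_source.measurableSet.inter (this hNm)
    convert h2 using 1
    ext x
    by_cases hx : x ∈ e.source <;> simp [hx]
  have h1 : (Measure.map e.symm ((volume : Measure (EucSp n)).restrict e.target))
      (e.source ∩ e ⁻¹' N) = 0 := by
    rw [Measure.map_apply_of_aemeasurable hm hs,
      Measure.restrict_apply' e.open_target.measurableSet]
    refine measure_mono_null ?_ hN0
    rintro y ⟨hy, hyt⟩
    simpa [e.right_inv hyt] using hy.2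
  have h2 : (Measure.map e.symm ((volume : Measure (EucSp n)).restrict e.target)) e.sourceᶜ = 0 := by
    rw [Measure.map_apply_of_aemeasurable hm e.open_source.measurableSet.compl,
      Measure.restrict_apply' e.open_target.measurableSet]
    convert measure_empty (μ := (volume : Measure (EucSp n)))
    ext y
    simp only [mem_inter_iff, mem_preimage, mem_compl_iff, mem_empty_iff_false, iff_false, not_and]
    exact fun h1 h2 => h1 (e.map_target h2)
  filter_upwards [measure_eq_zero_iff_ae_notMem.1 h1, measure_eq_zero_iff_ae_notMem.1 h2]
    with x hx1 hx2
  by_contra hpx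
  exact hx1 ⟨by simpa using hx2, hN hpx⟩

lemma abs_metricMatrix_le {c x : M} {B : ℝ} (h : ∀ i, ‖coordField n c i x‖ ≤ B) (i j : Fin n) :
    |metricMatrix n c x i j| ≤ B * B := by
  simp only [metricMatrix, Matrix.of_apply]
  exact (abs_real_inner_le_norm _ _).trans
    (mul_le_mul (h i) (h j) (norm_nonneg _) ((norm_nonneg _).trans (h i)))

/-- Near `c` the coordinate fields are bounded, so the Leibniz formula bounds `det g`; a small
neighbourhood of `c` also has its chart image in a unit ball. Finite volume of bounded sets comes
from here once `M` is proper. -/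
instance isLocallyFiniteMeasure_riemannianVolume :
    IsLocallyFiniteMeasure (riemannianVolume n M) := by
  refine ⟨fun c => ?_⟩
  obtain ⟨B, hB, h⟩ := eventually_norm_coordField_le (n := n) c
  have hcs := mem_chart_source (EucSp n) c
  obtain ⟨D, hD⟩ : ∃ D : ℝ, ∀ x : M, (∀ i, ‖coordField n c i x‖ ≤ B) →
      Real.sqrt (metricMatrix n c x).det ≤ D := by
    refine ⟨Real.sqrt ((Fintype.card (Fin n)).factorial • (B * B) ^ Fintype.card (Fin n)),
      fun x hx => Real.sqrt_le_sqrt ((le_abs_self _).trans ?_)⟩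
    exact Matrix.det_le (abv := AbsoluteValue.abs) fun i j => abs_metricMatrix_le hx i j
  set e := chartAt (EucSp n) c
  have hcont : ContinuousAt e.symm (e c) := e.continuousAt_symm (e.map_source hcs)
  obtain ⟨V, hV, hVo, hcV⟩ := eventually_nhds_iff.1 h
  set U := V ∩ e.source ∩ (e.source ∩ e ⁻¹' Metric.ball (e c) 1)
  have hUo : IsOpen U := (hVo.inter e.open_source).inter
    (e.isOpen_inter_preimage Metric.isOpen_ball)
  have hcU : c ∈ U := ⟨⟨hcV, hcs⟩, hcs, by simp⟩
  refine ⟨U, hUo.mem_nhds hcU, ?_⟩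
  have h1 : riemannianVolume n M U = chartVolume n c U := by
    rw [← riemannianVolume_restrict_chart, Measure.restrict_apply hUo.measurableSet,
      inter_eq_left.2 (fun x hx => hx.1.2)]
  rw [h1, chartVolume_apply c hUo.measurableSet]
  calc _ ≤ ∫⁻ y in e.target ∩ e.symm ⁻¹' U, ENNReal.ofReal D :=
        setLIntegral_mono' (measurableSet_chart_preimage c hUo.measurableSet) fun y hy =>
          ENNReal.ofReal_le_ofReal (hD _ (hV _ hy.2.1.1))
    _ ≤ ENNReal.ofReal D * volume (Metric.ball (e c) 1) := by
        rw [setLIntegral_const]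
        gcongr
        rintro y ⟨hy1, hy2⟩
        simpa [e.right_inv hy1] using hy2.2.2
    _ < ⊤ := ENNReal.mul_lt_top ENNReal.ofReal_lt_top Metric.isBounded_ball.measure_lt_top

/-- A function that agrees in each chart with a measurable one is almost everywhere measurable. -/
lemma aemeasurable_of_charts [SecondCountableTopology M] {f : M → ℝ}
    (h : ∀ c : M, AEMeasurable f
      ((riemannianVolume n M).restrict (chartAt (EucSp n) c).source)) :
    AEMeasurable f (riemannianVolume n M) := by
  obtain ⟨s, hs, hsU⟩ := TopologicalSpace.countable_cover_nhds
    fun c : M => chart_source_mem_nhds (EucSp n) c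
  have := hs.to_subtype
  have h2 : AEMeasurable f ((riemannianVolume n M).restrict
      (⋃ c : s, (chartAt (EucSp n) (c : M)).source)) :=
    (aemeasurable_iUnion_iff).2 fun c => h c
  have h3 : (⋃ c : s, (chartAt (EucSp n) (c : M)).source) = univ := by
    rw [← hsU, biUnion_eq_iUnion]
  rwa [h3, Measure.restrict_univ] at h2

lemma measurable_metricMatrix (c : M) (i j : Fin n) :
    AEMeasurable (fun x => metricMatrix n c x i j)
      ((riemannianVolume n M).restrict (chartAt (EucSp n) c).source) := by
  set S := (chartAt (EucSp n) c).source with hSdef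
  have hf : ∀ i, ContMDiffOn 𝓘(ℝ, EucSp n) (𝓘(ℝ, EucSp n).prod 𝓘(ℝ, EucSp n)) 1
      (fun x : M => (TotalSpace.mk' (EucSp n) x (coordField n c i x) :
        TotalSpace (EucSp n) (TangentSpace 𝓘(ℝ, EucSp n) (M := M)))) S := by
    intro i
    have := (trivializationAt (EucSp n) (TangentSpace 𝓘(ℝ, EucSp n) (M := M))
      c).contMDiffOn_localFrame_baseSet (I := 𝓘(ℝ, EucSp n)) 1
        (EuclideanSpace.basisFun (Fin n) ℝ).toBasis i
    rw [TangentBundle.trivializationAt_baseSet] at this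
    refine this.congr fun x hx => ?_
    have hx' : x ∈ (trivializationAt (EucSp n) (TangentSpace 𝓘(ℝ, EucSp n) (M := M))
      c).baseSet := by rwa [TangentBundle.trivializationAt_baseSet]
    rw [Trivialization.localFrame_apply_of_mem_baseSet _ _ hx']
    simp [coordField, Trivialization.basisAt, Trivialization.symmL_apply _ hx']
  have : IsContMDiffRiemannianBundle 𝓘(ℝ, EucSp n) 1 (EucSp n)
      (fun x : M => TangentSpace 𝓘(ℝ, EucSp n) x) :=
    IsContMDiffRiemannianBundle.of_le (n := ∞) (by norm_cast)
  have hc : ContinuousOn (fun x => metricMatrix n c x i j) S :=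
    fun x hx => ((hf i x hx).inner_bundle (hf j x hx)).continuousWithinAt
  exact hc.aemeasurable (chartAt (EucSp n) c).open_source.measurableSet

/-- The coordinates of the gradient: `(∇u)ⁱ = gⁱʲ ∂ⱼu`. -/
lemma grad_eq_sum {c x : M} (hx : x ∈ (chartAt (EucSp n) c).source) (u : M → ℝ) :
    chartDeriv n c x (grad n u x) = ∑ i, ((metricMatrix n c x)⁻¹.mulVec fun j =>
      fderiv ℝ (u ∘ (chartAt (EucSp n) c).symm) (chartAt (EucSp n) c x)
        (EuclideanSpace.basisFun (Fin n) ℝ j)) i • EuclideanSpace.basisFun (Fin n) ℝ i := by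
  set b := EuclideanSpace.basisFun (Fin n) ℝ
  set p : Fin n → ℝ := fun i => b.repr (chartDeriv n c x (grad n u x)) i with hp
  have hsum : grad n u x = ∑ i, p i • coordField n c i x := by
    rw [← symmL_chartDeriv hx (grad n u x), ← b.sum_repr (chartDeriv n c x (grad n u x)), map_sum]
    exact Finset.sum_congr rfl fun i _ => by rw [map_smul]; rfl
  have hGp : (metricMatrix n c x).mulVec p = fun j =>
      fderiv ℝ (u ∘ (chartAt (EucSp n) c).symm) (chartAt (EucSp n) c x) (b j) := by
    ext j
    have h1 := inner_grad_eq_fderiv hx u (coordField n c j x)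
    rw [chartDeriv_coordField hx] at h1
    rw [← h1, hsum, sum_inner]
    simp only [Matrix.mulVec, dotProduct, metricMatrix, Matrix.of_apply, real_inner_smul_left]
    exact Finset.sum_congr rfl fun i _ => by rw [mul_comm, real_inner_comm]
  -- A kernel vector of the Gram matrix gives a tangent vector orthogonal to all coordinate fields,
  -- hence to itself.
  have hdet : IsUnit (metricMatrix n c x).det := by
    rw [isUnit_iff_ne_zero]
    intro h0
    obtain ⟨q, hq0, hq⟩ := Matrix.exists_mulVec_eq_zero_iff.2 h0
    set v : TangentSpace 𝓘(ℝ, EucSp n) x := ∑ i, q i • coordField n c i x with hv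
    have hvj : ∀ j, inner ℝ (coordField n c j x) v = 0 := by
      intro j
      rw [hv, inner_sum, ← show (metricMatrix n c x).mulVec q j = 0 from congrFun hq j]
      simp only [Matrix.mulVec, dotProduct, metricMatrix, Matrix.of_apply, real_inner_smul_right]
      exact Finset.sum_congr rfl fun i _ => mul_comm _ _
    have hv0 : v = 0 := by
      have h1 : inner ℝ (∑ i, q i • coordField n c i x) v = 0 := by
        rw [sum_inner]
        exact Finset.sum_eq_zero fun i _ => by rw [real_inner_smul_left, hvj, mul_zero]
      exact inner_self_eq_zero.1 h1
    have hT : ∑ i, q i • b i = 0 := by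
      rw [← map_zero (chartDeriv n c x), ← hv0, hv, map_sum]
      exact Finset.sum_congr rfl fun i _ => by rw [map_smul, chartDeriv_coordField hx]
    refine hq0 (funext fun i => ?_)
    exact (Fintype.linearIndependent_iff.1 b.orthonormal.linearIndependent) q hT i
  rw [← hGp, Matrix.mulVec_mulVec, Matrix.nonsing_inv_mul _ hdet,
    Matrix.one_mulVec]
  exact (b.sum_repr _).symm

/-- The pointwise inner product of two gradients is measurable. -/
lemma aemeasurable_inner_grad [SecondCountableTopology M] (u w : M → ℝ) :
    AEMeasurable (fun x => inner ℝ (grad n u x) (grad n w x)) (riemannianVolume n M) := by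
  refine aemeasurable_of_charts fun c => ?_
  set e := chartAt (EucSp n) c
  have hS := e.open_source.measurableSet
  have he : AEMeasurable e ((riemannianVolume n M).restrict e.source) :=
    e.continuousOn.aemeasurable hS
  -- The derivative of an arbitrary function is measurable, so nothing is required of `u` and `w`.
  have hd : ∀ (u : M → ℝ) (v : EucSp n), AEMeasurable (fun x => fderiv ℝ (u ∘ e.symm) (e x) v)
      ((riemannianVolume n M).restrict e.source) := fun u v =>
    (measurable_fderiv_apply_const ℝ (u ∘ e.symm) v).comp_aemeasurable he
  have hG : AEMeasurable (fun x => (fun i j => metricMatrix n c x i j : Fin n → Fin n → ℝ))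
      ((riemannianVolume n M).restrict e.source) :=
    aemeasurable_pi_lambda _ fun i => aemeasurable_pi_lambda _ fun j => measurable_metricMatrix c i j
  have hGi : ∀ i j, AEMeasurable (fun x => (metricMatrix n c x)⁻¹ i j)
      ((riemannianVolume n M).restrict e.source) := by
    intro i j
    have h1 : Measurable fun A : Fin n → Fin n → ℝ => ((Matrix.of A)⁻¹ : Matrix _ _ ℝ) i j := by
      have hof : Continuous fun A : Fin n → Fin n → ℝ => Matrix.of A := continuous_id
      simp only [Matrix.inv_def, Ring.inverse_eq_inv', Matrix.smul_apply, smul_eq_mul]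
      exact (hof.matrix_det.measurable.inv).mul
        ((hof.matrix_adjugate.matrix_elem i j).measurable)
    exact h1.comp_aemeasurable hG
  have : AEMeasurable (fun x => ∑ i, (∑ j, (metricMatrix n c x)⁻¹ i j *
      fderiv ℝ (w ∘ e.symm) (e x) (EuclideanSpace.basisFun (Fin n) ℝ j)) *
        fderiv ℝ (u ∘ e.symm) (e x) (EuclideanSpace.basisFun (Fin n) ℝ i))
      ((riemannianVolume n M).restrict e.source) := by
    refine Finset.aemeasurable_fun_sum _ fun i _ => AEMeasurable.mul ?_ (hd _ _)
    exact Finset.aemeasurable_fun_sum _ fun j _ => (hGi i j).mul (hd _ _)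
  refine this.congr ?_
  filter_upwards [ae_restrict_mem hS] with x hx
  rw [inner_grad_eq_fderiv hx, grad_eq_sum hx, map_sum]
  refine Finset.sum_congr rfl fun i _ => ?_
  rw [map_smul, smul_eq_mul]
  rfl

end VolumeInCharts

/-! ### Mollification of Lipschitz functions -/

section Mollification

open scoped Convolution
open ContinuousLinearMap Filter

variable {E : Type*} [NormedAddCommGroup E] [InnerProductSpace ℝ E] [FiniteDimensional ℝ E]
  [MeasurableSpace E] [BorelSpace E]

variable (E) in
/-- A standard bump function supported in the ball of radius `1 / (k + 1)`. -/
def mollifierBump (k : ℕ) : ContDiffBump (0 : E) where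
  rIn := 1 / (k + 1) / 2
  rOut := 1 / (k + 1)
  rIn_pos := by positivity
  rIn_lt_rOut := half_lt_self (by positivity)

/-- The `k`-th mollification of a function on a Euclidean space. -/
def mollify (g : E → ℝ) (k : ℕ) : E → ℝ :=
  (mollifierBump E k).normed volume ⋆[lsmul ℝ ℝ, volume] g

lemma tendsto_mollifierBump_rOut :
    Tendsto (fun k => (mollifierBump E k).rOut) atTop (𝓝 0) :=
  tendsto_one_div_add_atTop_nhds_zero_nat

lemma mollify_apply (g : E → ℝ) (k : ℕ) (x : E) :
    mollify g k x = ∫ t, (mollifierBump E k).normed volume t * g (x - t) := by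
  simp [mollify, convolution_def, lsmul_apply]

lemma contDiff_mollify {g : E → ℝ} (hg : Continuous g) (k : ℕ) : ContDiff ℝ ∞ (mollify g k) :=
  HasCompactSupport.contDiff_convolution_left _ (mollifierBump E k).hasCompactSupport_normed
    (mollifierBump E k).contDiff_normed hg.locallyIntegrable

lemma tendsto_mollify {g : E → ℝ} (hg : Continuous g) (x : E) :
    Tendsto (fun k => mollify g k x) atTop (𝓝 (g x)) :=
  ContDiffBump.convolution_tendsto_right_of_continuous tendsto_mollifierBump_rOut hg x

lemma mollify_nonneg {g : E → ℝ} (hg : ∀ x, 0 ≤ g x) (k : ℕ) (x : E) : 0 ≤ mollify g k x := by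
  rw [mollify_apply]
  exact integral_nonneg fun t => mul_nonneg ((mollifierBump E k).nonneg_normed t) (hg _)

lemma integrable_mollifier_mul {g : E → ℝ} (hg : Continuous g) (k : ℕ) (x : E) :
    Integrable fun t => (mollifierBump E k).normed volume t * g (x - t) := by
  refine Continuous.integrable_of_hasCompactSupport ?_ ?_
  · exact (mollifierBump E k).continuous_normed.mul (hg.comp (continuous_const.sub continuous_id))
  · exact (mollifierBump E k).hasCompactSupport_normed.mul_right

lemma mollify_le {g : E → ℝ} (hg : Continuous g) {B : ℝ} (hB : ∀ x, g x ≤ B) (k : ℕ) (x : E) :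
    mollify g k x ≤ B := by
  have h : ∫ t, (mollifierBump E k).normed volume t * B = B := by
    rw [integral_mul_const, (mollifierBump E k).integral_normed, one_mul]
  rw [mollify_apply, ← h]
  exact integral_mono (integrable_mollifier_mul hg k x)
    ((mollifierBump E k).integrable_normed.mul_const _) fun t =>
      mul_le_mul_of_nonneg_left (hB _) ((mollifierBump E k).nonneg_normed t)

lemma lipschitzWith_mollify {g : E → ℝ} {L : NNReal} (hg : LipschitzWith L g) (k : ℕ) :
    LipschitzWith L (mollify g k) := by
  refine LipschitzWith.of_dist_le_mul fun x y => ?_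
  rw [Real.dist_eq, mollify_apply, mollify_apply, ← integral_sub
    (integrable_mollifier_mul hg.continuous k x) (integrable_mollifier_mul hg.continuous k y)]
  have h : ∫ t, (mollifierBump E k).normed volume t * (L * dist x y) = L * dist x y := by
    rw [integral_mul_const, (mollifierBump E k).integral_normed, one_mul]
  rw [← h, ← Real.norm_eq_abs]
  have hi : Integrable fun t => (mollifierBump E k).normed volume t * ((L : ℝ) * dist x y) :=
    (mollifierBump E k).integrable_normed.mul_const _
  refine norm_integral_le_of_norm_le hi (ae_of_all _ fun t => ?_)
  rw [← mul_sub, norm_mul, Real.norm_of_nonneg ((mollifierBump E k).nonneg_normed t),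
    ← dist_eq_norm]
  refine mul_le_mul_of_nonneg_left ?_ ((mollifierBump E k).nonneg_normed t)
  simpa using hg.dist_le_mul (x - t) (y - t)

lemma mollify_eq_zero {g : E → ℝ} {k : ℕ} {x : E}
    (hx : x ∉ Metric.cthickening (1 / (k + 1)) (tsupport g)) : mollify g k x = 0 := by
  rw [mollify_apply]
  refine integral_eq_zero_of_ae (ae_of_all _ fun t => ?_)
  by_contra h
  have h1 : t ∈ Metric.ball (0 : E) (1 / (k + 1)) := by
    rw [← show (mollifierBump E k).rOut = 1 / (k + 1) from rfl,
      ← (mollifierBump E k).support_normed_eq (μ := volume)]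
    exact left_ne_zero_of_mul h
  have h2 : x - t ∈ tsupport g := subset_tsupport _ (right_ne_zero_of_mul h)
  refine hx (Metric.mem_cthickening_of_dist_le x (x - t) _ _ h2 ?_)
  simpa [dist_eq_norm] using (mem_ball_zero_iff.1 h1).le

/-- The derivative first falls on the bump; integration by parts for Lipschitz functions moves it to
`g`. The derivative of the mollification is thus an average of the derivative of `g`. -/
lemma fderiv_mollify_apply {g : E → ℝ} {L : NNReal} (hg : LipschitzWith L g)
    (k : ℕ) (x v : E) :
    fderiv ℝ (mollify g k) x v = ((mollifierBump E k).normed volume ⋆[lsmul ℝ ℝ, volume]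
      fun y => lineDeriv ℝ g y v) x := by
  set φ := (mollifierBump E k).normed (volume : Measure E) with hφ
  have hφs : ContDiff ℝ 1 φ := (mollifierBump E k).contDiff_normed
  have hφc : HasCompactSupport φ := (mollifierBump E k).hasCompactSupport_normed
  have hli : LocallyIntegrable g (volume : Measure E) := hg.continuous.locallyIntegrable
  have h1 : HasFDerivAt (mollify g k)
      ((g ⋆[((lsmul ℝ ℝ : ℝ →L[ℝ] ℝ →L[ℝ] ℝ).flip).precompR E, volume] fderiv ℝ φ) x) x := by
    have := hφc.hasFDerivAt_convolution_right (lsmul ℝ ℝ : ℝ →L[ℝ] ℝ →L[ℝ] ℝ).flip hli hφs x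
    rwa [convolution_flip] at this
  rw [h1.fderiv, convolution_precompR_apply _ hli (hφc.fderiv ℝ)
    (hφs.continuous_fderiv one_ne_zero)]
  obtain ⟨D, hD⟩ := hφs.lipschitzWith_of_hasCompactSupport hφc one_ne_zero
  have hψ : LipschitzWith D fun t => φ (x - t) := by
    refine LipschitzWith.of_dist_le_mul fun y z => ?_
    simpa only [dist_sub_left] using hD.dist_le_mul (x - y) (x - z)
  have hψc : HasCompactSupport fun t => φ (x - t) :=
    hφc.comp_homeomorph (Homeomorph.subLeft x)
  have key := hg.integral_lineDeriv_mul_eq (μ := volume) hψ hψc v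
  have hline : ∀ t, lineDeriv ℝ (fun t => φ (x - t)) t (-v) = fderiv ℝ φ (x - t) v := by
    intro t
    have hd : HasFDerivAt (fun t => φ (x - t)) (-(fderiv ℝ φ (x - t))) t := by
      have h := ((hφs.differentiable one_ne_zero) (x - t)).hasFDerivAt.comp t
        ((hasFDerivAt_id t).const_sub x)
      rwa [ContinuousLinearMap.comp_neg, ContinuousLinearMap.comp_id] at h
    rw [hd.differentiableAt.lineDeriv_eq_fderiv, hd.fderiv]
    simp
  rw [convolution_def, convolution_eq_swap]
  simp only [flip_apply, lsmul_apply, smul_eq_mul]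
  simp only [hline] at key
  rw [← key]
  exact integral_congr_ae (ae_of_all _ fun t => mul_comm _ _)

/-- Averages of the line derivatives along a basis converge at almost every point by Lebesgue
differentiation, and Rademacher's theorem assembles these line derivatives into `fderiv`. -/
lemma ae_tendsto_fderiv_mollify {g : E → ℝ} {L : NNReal} (hg : LipschitzWith L g) :
    ∀ᵐ x, ∀ v, Tendsto (fun k => fderiv ℝ (mollify g k) x v) atTop (𝓝 (fderiv ℝ g x v)) := by
  set b := stdOrthonormalBasis ℝ E
  have h1 : ∀ᵐ x, ∀ i, Tendsto (fun k => fderiv ℝ (mollify g k) x (b i)) atTop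
      (𝓝 (lineDeriv ℝ g x (b i))) := by
    rw [ae_all_iff]
    intro i
    -- Here `K = 2` is the ratio of outer to inner radius of the bumps. A bounded ratio is what lets
    -- the averages converge almost everywhere.
    have := ContDiffBump.ae_convolution_tendsto_right_of_locallyIntegrable (μ := volume)
      (φ := mollifierBump E) (l := atTop) (K := 2) tendsto_mollifierBump_rOut
      (Eventually.of_forall fun k => le_of_eq (by simp [mollifierBump]; ring))
      (hg.locallyIntegrable_lineDeriv (μ := volume) (b i))
    filter_upwards [this] with x hx
    simpa only [fderiv_mollify_apply hg] using hx
  filter_upwards [h1, hg.ae_differentiableAt] with x hx hdx v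
  have hlin : ∀ A : E →L[ℝ] ℝ, A v = ∑ i, b.repr v i * A (b i) := by
    intro A
    conv_lhs => rw [← b.sum_repr v, map_sum]
    exact Finset.sum_congr rfl fun i _ => by rw [map_smul, smul_eq_mul]
  simp only [hlin]
  refine tendsto_finsetSum _ fun i _ => Tendsto.const_mul _ ?_
  rw [← hdx.lineDeriv_eq_fderiv]
  exact hx i

/-- A locally Lipschitz function with compact support is Lipschitz. -/
lemma exists_lipschitzWith_of_hasCompactSupport {g : E → ℝ} (hg : LocallyLipschitz g)
    (hc : HasCompactSupport g) : ∃ L, LipschitzWith L g := by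
  obtain ⟨R, hR⟩ := hc.isBounded.subset_closedBall 0
  obtain ⟨K, hK⟩ := (hg.locallyLipschitzOn
    (s := Metric.closedBall 0 (R + 1))).exists_lipschitzOnWith_of_compact
    (isCompact_closedBall (0 : E) (R + 1))
  obtain ⟨B, hB⟩ := hc.exists_bound_of_continuous hg.continuous
  have hB0 : 0 ≤ B := (norm_nonneg _).trans (hB 0)
  -- The margin `1` around the support serves here: if `x` is in the support and `y` outside the
  -- larger ball, their distance is at least `1`, so the sup bound `B` acts as a Lipschitz constant.
  have hfar : ∀ x y : E, x ∈ Metric.closedBall (0 : E) (R + 1) →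
      y ∉ Metric.closedBall (0 : E) (R + 1) → dist (g x) (g y) ≤ B * dist x y := by
    intro x y hx hy
    have hgy : g y = 0 := by
      by_contra h
      exact hy (Metric.closedBall_subset_closedBall (by linarith) (hR (subset_tsupport _ h)))
    rw [hgy, dist_zero_right]
    by_cases hxs : x ∈ tsupport g
    · have h1 : dist x 0 ≤ R := hR hxs
      have h2 : R + 1 < dist y 0 := by simpa using hy
      have h3 : 1 ≤ dist x y := by linarith [dist_triangle y x 0, dist_comm x y]
      nlinarith [hB x]
    · rw [image_eq_zero_of_notMem_tsupport hxs, norm_zero]; positivity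
  refine ⟨max K B.toNNReal, LipschitzWith.of_dist_le_mul fun x y => ?_⟩
  have hKm : (K : ℝ) ≤ (max K B.toNNReal : NNReal) := by exact_mod_cast le_max_left _ _
  have hBm : B ≤ (max K B.toNNReal : NNReal) := by
    refine (Real.le_coe_toNNReal B).trans ?_
    exact_mod_cast le_max_right _ _
  by_cases hx : x ∈ Metric.closedBall (0 : E) (R + 1) <;>
    by_cases hy : y ∈ Metric.closedBall (0 : E) (R + 1)
  · exact (hK.dist_le_mul x hx y hy).trans (by gcongr)
  · exact (hfar x y hx hy).trans (by gcongr)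
  · rw [dist_comm, dist_comm x y]; exact (hfar y x hy hx).trans (by gcongr)
  · have h0 : ∀ z ∉ Metric.closedBall (0 : E) (R + 1), g z = 0 := fun z hz => by
      by_contra h
      exact hz (Metric.closedBall_subset_closedBall (by linarith) (hR (subset_tsupport _ h)))
    rw [h0 x hx, h0 y hy, dist_self]; positivity

end Mollification

/-! ### Lipschitz test functions supported in one chart -/

section TestFunctions

open Filter

variable {n : ℕ} {M : Type*} [TopologicalSpace M] [T2Space M] [SecondCountableTopology M]
  [ChartedSpace (EucSp n) M] [IsManifold 𝓘(ℝ, EucSp n) ∞ M]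
  [RiemannianBundle (fun x : M => TangentSpace 𝓘(ℝ, EucSp n) x)]
  [IsContMDiffRiemannianBundle 𝓘(ℝ, EucSp n) ∞ (EucSp n)
      (fun x : M => TangentSpace 𝓘(ℝ, EucSp n) x)]
  [MeasurableSpace M] [BorelSpace M]

lemma integrable_indicator_const_of_isCompact {K : Set M} (hK : IsCompact K) (B : ℝ) :
    Integrable (K.indicator fun _ => B) (riemannianVolume n M) :=
  (integrable_indicator_iff hK.measurableSet).2 (integrableOn_const hK.measure_lt_top.ne)

lemma grad_congr {u w : M → ℝ} {x : M} (h : u =ᶠ[𝓝 x] w) : grad n u x = grad n w x := by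
  refine ext_inner_right ℝ fun v => ?_
  have hx := mem_chart_source (EucSp n) x
  rw [inner_grad_eq_fderiv hx, inner_grad_eq_fderiv hx]
  congr 1
  refine Filter.EventuallyEq.fderiv_eq ?_
  have hc := (chartAt (EucSp n) x).continuousAt_symm ((chartAt (EucSp n) x).map_source hx)
  rw [ContinuousAt, (chartAt (EucSp n) x).left_inv hx] at hc
  exact hc.eventually h

lemma grad_eq_zero_of_notMem_tsupport {u : M → ℝ} {x : M} (hx : x ∉ tsupport u) :
    grad n u x = 0 := by
  have h : u =ᶠ[𝓝 x] fun _ => (0 : ℝ) := notMem_tsupport_iff_eventuallyEq.1 hx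
  rw [grad_congr h]
  exact grad_eq_zero_of_mfderiv mfderiv_const

lemma integrable_inner_grad {ρ ζ : M → ℝ} (hρ : ∀ᵐ x ∂(riemannianVolume n M), ‖grad n ρ x‖ = 1)
    (hζ : ChartLipschitz n ζ) (hc : HasCompactSupport ζ) :
    Integrable (fun x => inner ℝ (grad n ρ x) (grad n ζ x)) (riemannianVolume n M) := by
  obtain ⟨B, hB⟩ := hζ.exists_norm_grad_le hc
  refine (integrable_indicator_const_of_isCompact hc B).mono'
    (aemeasurable_inner_grad ρ ζ).aestronglyMeasurable ?_
  filter_upwards [hρ] with x hx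
  by_cases hxs : x ∈ tsupport ζ
  · rw [indicator_of_mem hxs]
    refine (norm_inner_le_norm _ _).trans ?_
    rw [hx, one_mul]
    exact hB x hxs
  · rw [indicator_of_notMem hxs, grad_eq_zero_of_notMem_tsupport hxs]
    simp

/-- If a distributional inequality `Δρ ≥ f` holds for smooth test functions, it holds for Lipschitz
test functions supported in a chart. -/
lemma weak_inequality_of_tsupport_subset_chart {ρ f : M → ℝ} (hf : Continuous f)
    (hρ : ∀ᵐ x ∂(riemannianVolume n M), ‖grad n ρ x‖ = 1)
    (hsm : ∀ η : M → ℝ, ContMDiff 𝓘(ℝ, EucSp n) 𝓘(ℝ, ℝ) ∞ η → HasCompactSupport η →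
      (∀ x, 0 ≤ η x) → ∫ x, f x * η x ∂(riemannianVolume n M) ≤
        -∫ x, inner ℝ (grad n ρ x) (grad n η x) ∂(riemannianVolume n M))
    {c : M} {U : Set M} (hU : IsOpen U) (hUs : U ⊆ (chartAt (EucSp n) c).source) {B : ℝ}
    (hB : ∀ x ∈ U, ∀ v, ‖chartDeriv n c x v‖ ≤ B * ‖v‖) {ζ : M → ℝ}
    (hζ0 : ∀ x, 0 ≤ ζ x) (hζc : HasCompactSupport ζ) (hζU : tsupport ζ ⊆ U)
    (hζL : LocallyLipschitzOn ((chartAt (EucSp n) c).target ∩ (chartAt (EucSp n) c).symm ⁻¹' U)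
      (ζ ∘ (chartAt (EucSp n) c).symm)) :
    ∫ x, f x * ζ x ∂(riemannianVolume n M) ≤
      -∫ x, inner ℝ (grad n ρ x) (grad n ζ x) ∂(riemannianVolume n M) := by
  classical
  set e := chartAt (EucSp n) c with he
  set W := e.target ∩ e.symm ⁻¹' U with hW
  have hWo : IsOpen W := e.isOpen_inter_preimage_symm hU
  -- The test function read in the chart, extended by zero to all of `EucSp n` so that it can be
  -- mollified.
  set g : EucSp n → ℝ := W.indicator (ζ ∘ e.symm) with hg
  set K' := e '' tsupport ζ with hK'
  have hK'c : IsCompact K' :=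
    IsCompact.image_of_continuousOn hζc (e.continuousOn.mono (hζU.trans hUs))
  have hK'W : K' ⊆ W := by
    rintro _ ⟨x, hx, rfl⟩
    exact ⟨e.map_source (hUs (hζU hx)), by
      simpa [e.left_inv (hUs (hζU hx))] using hζU hx⟩
  have hg0 : ∀ y ∉ K', g y = 0 := by
    intro y hy
    by_cases hyW : y ∈ W
    · rw [hg, indicator_of_mem hyW, Function.comp_apply]
      refine image_eq_zero_of_notMem_tsupport fun h => hy ⟨_, h, e.right_inv hyW.1⟩
    · rw [hg, indicator_of_notMem hyW]
  have hgt : ∀ y ∈ e.target, g y = ζ (e.symm y) := by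
    intro y hy
    by_cases hyW : y ∈ W
    · rw [hg, indicator_of_mem hyW, Function.comp_apply]
    · rw [hg, indicator_of_notMem hyW]
      refine (image_eq_zero_of_notMem_tsupport fun h => hyW ⟨hy, hζU h⟩).symm
  have hgcs : HasCompactSupport g := HasCompactSupport.intro hK'c hg0
  have hgts : tsupport g ⊆ K' := closure_minimal (fun y hy => by
    by_contra h; exact hy (hg0 y h)) hK'c.isClosed
  have hgpos : ∀ y, 0 ≤ g y := fun y => indicator_nonneg (fun y _ => hζ0 _) y
  have hgll : LocallyLipschitz g := by
    intro y
    by_cases hyW : y ∈ W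
    · obtain ⟨K, t, ht, hK⟩ := hζL hyW
      rw [hWo.nhdsWithin_eq hyW] at ht
      refine ⟨K, t ∩ W, inter_mem ht (hWo.mem_nhds hyW), fun a ha b hb => ?_⟩
      rw [hg, indicator_of_mem ha.2, indicator_of_mem hb.2]
      exact hK ha.1 hb.1
    · refine ⟨0, K'ᶜ, hK'c.isClosed.isOpen_compl.mem_nhds fun h => hyW (hK'W h),
        fun a ha b hb => ?_⟩
      rw [hg0 a ha, hg0 b hb]; simp
  obtain ⟨L, hL⟩ := exists_lipschitzWith_of_hasCompactSupport hgll hgcs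
  obtain ⟨A, hA⟩ := hgcs.exists_bound_of_continuous hL.continuous
  obtain ⟨δ, hδ, hδW⟩ := hK'c.exists_cthickening_subset_open hWo hK'W
  set K'' := Metric.cthickening δ K' with hK''
  have hK''c : IsCompact K'' := hK'c.cthickening
  set Q := e.symm '' K'' with hQ
  have hQc : IsCompact Q := hK''c.image_of_continuousOn
    (e.continuousOn_symm.mono (hδW.trans inter_subset_left))
  have hQU : Q ⊆ U := by
    rintro _ ⟨y, hy, rfl⟩
    exact (hδW hy).2
  -- Starting at index `N` keeps all mollifications supported in the fixed compact set `K''` inside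
  -- `W`, so that they pull back to smooth functions on `M`.
  obtain ⟨N, hN⟩ := exists_nat_one_div_lt hδ
  set gk : ℕ → EucSp n → ℝ := fun k => mollify g (k + N) with hgk
  have hgk0 : ∀ k, ∀ y ∉ K'', gk k y = 0 := by
    intro k y hy
    refine mollify_eq_zero fun h => hy ?_
    refine Metric.cthickening_subset_of_subset δ hgts (Metric.cthickening_mono ?_ _ h)
    refine le_trans ?_ hN.le
    gcongr
    simp
  set ζk : ℕ → M → ℝ := fun k => e.source.indicator (gk k ∘ e) with hζk
  have hζk0 : ∀ k, ∀ x ∉ Q, ζk k x = 0 := by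
    intro k x hx
    by_cases hxs : x ∈ e.source
    · simp only [hζk, indicator_of_mem hxs, Function.comp_apply]
      exact hgk0 k _ fun h => hx ⟨_, h, e.left_inv hxs⟩
    · simp only [hζk, indicator_of_notMem hxs]
  have hζkts : ∀ k, tsupport (ζk k) ⊆ Q := fun k => closure_minimal (fun y hy => by
    by_contra h; exact hy (hζk0 k y h)) hQc.isClosed
  have hζksm : ∀ k, ContMDiff 𝓘(ℝ, EucSp n) 𝓘(ℝ, ℝ) ∞ (ζk k) := by
    intro k x
    by_cases hxs : x ∈ e.source
    · have h1 : ContMDiffAt 𝓘(ℝ, EucSp n) 𝓘(ℝ, ℝ) ∞ (gk k ∘ e) x :=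
        ContMDiffAt.comp x (contDiff_mollify hL.continuous _).contMDiff.contMDiffAt
          ((contMDiffOn_chart (I := 𝓘(ℝ, EucSp n)) (x := c)).contMDiffAt
            (e.open_source.mem_nhds hxs))
      refine h1.congr_of_eventuallyEq ?_
      filter_upwards [e.open_source.mem_nhds hxs] with y hy
      simp only [hζk, indicator_of_mem hy]
    · refine contMDiffAt_const (c := (0 : ℝ)) |>.congr_of_eventuallyEq ?_
      filter_upwards [hQc.isClosed.isOpen_compl.mem_nhds fun h => hxs (hUs (hQU h))] with y hy
      exact hζk0 k y hy
  have hζkpos : ∀ k x, 0 ≤ ζk k x := fun k x =>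
    indicator_nonneg (fun y _ => mollify_nonneg hgpos _ _) x
  have hζg : ∀ x, e.source.indicator (g ∘ e) x = ζ x := by
    intro x
    by_cases hxs : x ∈ e.source
    · rw [indicator_of_mem hxs, Function.comp_apply, hgt _ (e.map_source hxs), e.left_inv hxs]
    · rw [indicator_of_notMem hxs]
      exact (image_eq_zero_of_notMem_tsupport fun h => hxs (hUs (hζU h))).symm
  have hζlim : ∀ x, Tendsto (fun k => ζk k x) atTop (𝓝 (ζ x)) := by
    intro x
    rw [← hζg]
    by_cases hxs : x ∈ e.source
    · simp only [hζk, indicator_of_mem hxs, Function.comp_apply]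
      exact (tendsto_mollify hL.continuous (e x)).comp (tendsto_add_atTop_nat N)
    · simp only [hζk, indicator_of_notMem hxs]
      exact tendsto_const_nhds
  obtain ⟨D, hD⟩ := hQc.exists_bound_of_continuousOn hf.continuousOn
  have hlim1 : Tendsto (fun k => ∫ x, f x * ζk k x ∂(riemannianVolume n M)) atTop
      (𝓝 (∫ x, f x * ζ x ∂(riemannianVolume n M))) := by
    refine tendsto_integral_of_dominated_convergence (Q.indicator fun _ => D * A)
      (fun k => ?_) (integrable_indicator_const_of_isCompact hQc _) (fun k => ?_) ?_
    · exact (hf.mul (hζksm k).continuous).aestronglyMeasurable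
    · refine ae_of_all _ fun x => ?_
      by_cases hx : x ∈ Q
      · rw [indicator_of_mem hx, norm_mul]
        refine mul_le_mul (hD x hx) ?_ (norm_nonneg _) ((norm_nonneg _).trans (hD x hx))
        rw [Real.norm_of_nonneg (hζkpos k x)]
        simp only [hζk, indicator_of_mem (hUs (hQU hx)), Function.comp_apply]
        exact mollify_le hL.continuous (fun y => (Real.le_norm_self _).trans (hA y)) _ _
      · rw [indicator_of_notMem hx, hζk0 k x hx]; simp
    · exact ae_of_all _ fun x => (hζlim x).const_mul _
  have hgradk : ∀ k, ∀ x ∈ e.source, ∀ v, inner ℝ (grad n (ζk k) x) v =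
      fderiv ℝ (gk k) (e x) (chartDeriv n c x v) := by
    intro k x hx v
    rw [inner_grad_eq_fderiv hx]
    congr 1
    refine Filter.EventuallyEq.fderiv_eq ?_
    filter_upwards [e.open_target.mem_nhds (e.map_source hx)] with y hy
    simp only [Function.comp_apply, hζk]
    rw [indicator_of_mem (e.map_target hy), Function.comp_apply, e.right_inv hy]
  have hgrad : ∀ x ∈ e.source, ∀ v, inner ℝ (grad n ζ x) v =
      fderiv ℝ g (e x) (chartDeriv n c x v) := by
    intro x hx v
    rw [inner_grad_eq_fderiv hx]
    congr 1
    refine Filter.EventuallyEq.fderiv_eq ?_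
    filter_upwards [e.open_target.mem_nhds (e.map_source hx)] with y hy
    rw [hgt y hy, Function.comp_apply]
  have hlim2 : Tendsto (fun k => ∫ x, inner ℝ (grad n ρ x) (grad n (ζk k) x)
      ∂(riemannianVolume n M)) atTop
      (𝓝 (∫ x, inner ℝ (grad n ρ x) (grad n ζ x) ∂(riemannianVolume n M))) := by
    -- Mollification preserves the Lipschitz constant `L`, and `B` bounds the coordinate expression
    -- of the unit vector `∇ρ`.
    refine tendsto_integral_of_dominated_convergence (Q.indicator fun _ => L * B)
      (fun k => (aemeasurable_inner_grad _ _).aestronglyMeasurable)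
      (integrable_indicator_const_of_isCompact hQc _) (fun k => ?_) ?_
    · filter_upwards [hρ] with x hx
      by_cases hxQ : x ∈ Q
      · rw [indicator_of_mem hxQ, real_inner_comm, hgradk k x (hUs (hQU hxQ))]
        refine (ContinuousLinearMap.le_of_opNorm_le _
          (norm_fderiv_le_of_lipschitz ℝ (lipschitzWith_mollify hL _)) _).trans ?_
        gcongr
        simpa [hx] using hB x (hQU hxQ) (grad n ρ x)
      · rw [indicator_of_notMem hxQ,
          grad_eq_zero_of_notMem_tsupport fun h => hxQ (hζkts k h)]
        simp
    · have h1 := ae_restrict_source_of_ae (n := n) c (ae_tendsto_fderiv_mollify hL)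
      rw [ae_restrict_iff' e.open_source.measurableSet] at h1
      filter_upwards [h1] with x hx
      by_cases hxs : x ∈ e.source
      · simp only [fun y => real_inner_comm y (grad n ρ x)]
        simp only [hgradk _ x hxs, hgrad x hxs]
        exact (hx hxs _).comp (tendsto_add_atTop_nat N)
      · have h2 : ∀ k, grad n (ζk k) x = 0 := fun k =>
          grad_eq_zero_of_notMem_tsupport fun h => hxs (hUs (hQU (hζkts k h)))
        rw [grad_eq_zero_of_notMem_tsupport fun h => hxs (hUs (hζU h))]
        simp only [h2]
        exact tendsto_const_nhds
  exact le_of_tendsto_of_tendsto' hlim1 hlim2.neg fun k =>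
    hsm _ (hζksm k) (HasCompactSupport.intro hQc (hζk0 k)) (hζkpos k)

end TestFunctions

/-! ### Arbitrary Lipschitz test functions of compact support -/

section LipschitzTestFunctions

open Filter

variable {n : ℕ} {M : Type*} [TopologicalSpace M] [T2Space M] [SecondCountableTopology M]
  [ChartedSpace (EucSp n) M] [IsManifold 𝓘(ℝ, EucSp n) ∞ M]
  [RiemannianBundle (fun x : M => TangentSpace 𝓘(ℝ, EucSp n) x)]
  [IsContMDiffRiemannianBundle 𝓘(ℝ, EucSp n) ∞ (EucSp n)
      (fun x : M => TangentSpace 𝓘(ℝ, EucSp n) x)]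
  [MeasurableSpace M] [BorelSpace M]

/-- The chain rule for the gradient of `F (u, v)`. -/
lemma inner_grad_comp₂ {u v : M → ℝ} {x : M}
    (hu : MDifferentiableAt 𝓘(ℝ, EucSp n) 𝓘(ℝ, ℝ) u x)
    (hv : MDifferentiableAt 𝓘(ℝ, EucSp n) 𝓘(ℝ, ℝ) v x) {F : ℝ × ℝ → ℝ} {a b : ℝ}
    (hF : HasFDerivAt F (a • ContinuousLinearMap.fst ℝ ℝ ℝ + b • ContinuousLinearMap.snd ℝ ℝ ℝ)
      (u x, v x)) :
    MDifferentiableAt 𝓘(ℝ, EucSp n) 𝓘(ℝ, ℝ) (fun y => F (u y, v y)) x ∧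
      ∀ w, inner ℝ (grad n (fun y => F (u y, v y)) x) w =
        a * inner ℝ (grad n u x) w + b * inner ℝ (grad n v x) w := by
  have hx := mem_chart_source (EucSp n) x
  set e := chartAt (EucSp n) x
  have hu' := (mdifferentiableAt_iff_chart hx u).1 hu
  have hv' := (mdifferentiableAt_iff_chart hx v).1 hv
  have hF' : HasFDerivAt F (a • ContinuousLinearMap.fst ℝ ℝ ℝ + b • ContinuousLinearMap.snd ℝ ℝ ℝ)
      ((u ∘ e.symm) (e x), (v ∘ e.symm) (e x)) := by
    simpa [e.left_inv hx] using hF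
  have h := hF'.comp (e x) (hu'.hasFDerivAt.prodMk hv'.hasFDerivAt)
  refine ⟨(mdifferentiableAt_iff_chart hx _).2 h.differentiableAt, fun w => ?_⟩
  rw [inner_grad_eq_fderiv hx, inner_grad_eq_fderiv hx, inner_grad_eq_fderiv hx]
  have h2 : fderiv ℝ ((fun y => F (u y, v y)) ∘ e.symm) (e x) = _ := h.fderiv
  rw [h2]
  simp

lemma inner_grad_sum {ι : Type*} (s : Finset ι) {u : ι → M → ℝ} {x : M}
    (hu : ∀ i ∈ s, MDifferentiableAt 𝓘(ℝ, EucSp n) 𝓘(ℝ, ℝ) (u i) x)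
    (w : TangentSpace 𝓘(ℝ, EucSp n) x) :
    inner ℝ (grad n (fun y => ∑ i ∈ s, u i y) x) w = ∑ i ∈ s, inner ℝ (grad n (u i) x) w := by
  have hx := mem_chart_source (EucSp n) x
  simp only [inner_grad_eq_fderiv hx]
  set e := chartAt (EucSp n) x
  have h2 : fderiv ℝ ((fun y => ∑ i ∈ s, u i y) ∘ e.symm) (e x) =
      ∑ i ∈ s, fderiv ℝ (u i ∘ e.symm) (e x) :=
    (HasFDerivAt.fun_sum fun i hi =>
      ((mdifferentiableAt_iff_chart hx _).1 (hu i hi)).hasFDerivAt).fderiv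
  rw [h2, _root_.sum_apply]

/-- If a distributional inequality `Δρ ≥ f` holds for smooth test functions, it holds for Lipschitz
test functions. -/
theorem weak_inequality_of_chartLipschitz {ρ f : M → ℝ} (hf : Continuous f)
    (hρ : ∀ᵐ x ∂(riemannianVolume n M), ‖grad n ρ x‖ = 1)
    (hsm : ∀ η : M → ℝ, ContMDiff 𝓘(ℝ, EucSp n) 𝓘(ℝ, ℝ) ∞ η → HasCompactSupport η →
      (∀ x, 0 ≤ η x) → ∫ x, f x * η x ∂(riemannianVolume n M) ≤
        -∫ x, inner ℝ (grad n ρ x) (grad n η x) ∂(riemannianVolume n M))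
    {η : M → ℝ} (hη0 : ∀ x, 0 ≤ η x) (hηc : HasCompactSupport η) (hηL : ChartLipschitz n η)
    (hηd : ∀ᵐ x ∂(riemannianVolume n M), MDifferentiableAt 𝓘(ℝ, EucSp n) 𝓘(ℝ, ℝ) η x) :
    ∫ x, f x * η x ∂(riemannianVolume n M) ≤
      -∫ x, inner ℝ (grad n ρ x) (grad n η x) ∂(riemannianVolume n M) := by
  classical
  have hlc : LocallyCompactSpace M := ChartedSpace.locallyCompactSpace (EucSp n) M
  have hU : ∀ c : M, ∃ U : Set M, IsOpen U ∧ c ∈ U ∧ U ⊆ (chartAt (EucSp n) c).source ∧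
      (∃ B, ∀ x ∈ U, ∀ v, ‖chartDeriv n c x v‖ ≤ B * ‖v‖) ∧
      ∃ K, LipschitzOnWith K (η ∘ (chartAt (EucSp n) c).symm)
        ((chartAt (EucSp n) c).target ∩ (chartAt (EucSp n) c).symm ⁻¹' U) := by
    intro c
    obtain ⟨B, -, hB⟩ := eventually_norm_chartDeriv_le (n := n) c
    obtain ⟨K, V, hV, hK⟩ := hηL c
    have hcs := mem_chart_source (EucSp n) c
    set e := chartAt (EucSp n) c
    have hnhds : {x | ∀ v, ‖chartDeriv n c x v‖ ≤ B * ‖v‖} ∩ e.source ∩ e ⁻¹' V ∈ 𝓝 c :=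
      inter_mem (inter_mem hB (e.open_source.mem_nhds hcs))
        ((e.continuousAt hcs).preimage_mem_nhds hV)
    obtain ⟨U, hUsub, hUo, hcU⟩ := mem_nhds_iff.1 hnhds
    refine ⟨U, hUo, hcU, fun x hx => (hUsub hx).1.2, ⟨B, fun x hx => (hUsub hx).1.1⟩, K,
      hK.mono ?_⟩
    rintro y ⟨hy, hyU⟩
    simpa [e.right_inv hy] using (hUsub hyU).2
  choose U hUo hcU hUs hUB hUK using hU
  -- A partition of unity subordinate to the good neighbourhoods splits `η` into pieces `χ i * η`,
  -- finitely many of them nonzero by compactness.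
  obtain ⟨χ, hχ⟩ := SmoothPartitionOfUnity.exists_isSubordinate 𝓘(ℝ, EucSp n)
    (isClosed_univ (X := M)) U hUo fun x _ => mem_iUnion.2 ⟨x, hcU x⟩
  have hfin : {i | (Function.support (χ i) ∩ tsupport η).Nonempty}.Finite :=
    χ.locallyFinite.finite_nonempty_inter_compact hηc
  set S := hfin.toFinset with hS
  have hsum : ∀ x, η x = ∑ i ∈ S, χ i x * η x := by
    intro x
    by_cases hx : x ∈ tsupport η
    · rw [← Finset.sum_mul]
      have h1 := χ.sum_eq_one (mem_univ x)
      rw [finsum_eq_sum_of_support_subset _ (s := S) (fun i hi => by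
        simp only [hS, Finite.coe_toFinset]
        exact ⟨x, hi, hx⟩)] at h1
      rw [h1, one_mul]
    · simp [image_eq_zero_of_notMem_tsupport hx]
  have hχL : ∀ i, ChartLipschitz n fun x => χ i x * η x := fun i =>
    (chartLipschitz_of_contMDiff (χ i).contMDiff).mul hηL
  have hχc : ∀ i, HasCompactSupport fun x => χ i x * η x := fun i => hηc.mul_left
  have hpiece : ∀ i, ∫ x, f x * (χ i x * η x) ∂(riemannianVolume n M) ≤
      -∫ x, inner ℝ (grad n ρ x) (grad n (fun x => χ i x * η x) x) ∂(riemannianVolume n M) := by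
    intro c
    obtain ⟨B, hB⟩ := hUB c
    obtain ⟨K, hK⟩ := hUK c
    refine weak_inequality_of_tsupport_subset_chart hf hρ hsm (hUo c) (hUs c) hB
      (fun x => mul_nonneg (χ.nonneg c x) (hη0 x)) (hχc c)
      ((tsupport_mul_subset_left).trans (hχ c)) ?_
    intro y hy
    set e := chartAt (EucSp n) c
    have hχd : ContDiffAt ℝ 1 (χ c ∘ e.symm) y := by
      have h1 : ContMDiffOn 𝓘(ℝ, EucSp n) 𝓘(ℝ, ℝ) ∞ (χ c ∘ e.symm) e.target :=
        (χ c).contMDiff.comp_contMDiffOn (contMDiffOn_chart_symm (I := 𝓘(ℝ, EucSp n)) (x := c))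
      have h2 := (contMDiffOn_iff_contDiffOn.1 h1).contDiffAt (e.open_target.mem_nhds hy.1)
      exact h2.of_le (by norm_cast)
    obtain ⟨L, t, ht, hL⟩ := hχd.exists_lipschitzOnWith
    obtain ⟨L', t', ht', hL'⟩ := ((contDiff_fst.mul contDiff_snd).contDiffAt :
      ContDiffAt ℝ 1 (fun p : ℝ × ℝ => p.1 * p.2) (χ c (e.symm y), η (e.symm y))).exists_lipschitzOnWith
    set W := e.target ∩ e.symm ⁻¹' (U c) with hW
    have hWo : IsOpen W := e.isOpen_inter_preimage_symm (hUo c)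
    set w : EucSp n → ℝ × ℝ := fun z => (χ c (e.symm z), η (e.symm z))
    have hw : LipschitzOnWith (max L K) w (t ∩ W) :=
      (hL.mono inter_subset_left).prodMk (hK.mono inter_subset_right)
    have htW : t ∩ W ∈ 𝓝 y := inter_mem ht (hWo.mem_nhds hy)
    have hwt : w ⁻¹' t' ∈ 𝓝 y := (hw.continuousOn.continuousAt htW).preimage_mem_nhds ht'
    exact ⟨_, t ∩ W ∩ w ⁻¹' t', mem_nhdsWithin_of_mem_nhds (inter_mem htW hwt),
      hL'.comp (hw.mono inter_subset_left) fun z hz => hz.2⟩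
  have h1 : ∫ x, f x * η x ∂(riemannianVolume n M) =
      ∑ i ∈ S, ∫ x, f x * (χ i x * η x) ∂(riemannianVolume n M) := by
    rw [← integral_finsetSum]
    · refine integral_congr_ae (ae_of_all _ fun x => ?_)
      simp only
      rw [← Finset.mul_sum, ← hsum]
    · intro i _
      exact (hf.mul (hχL i).continuous).integrable_of_hasCompactSupport (hχc i).mul_left
  have h2 : ∫ x, inner ℝ (grad n ρ x) (grad n η x) ∂(riemannianVolume n M) =
      ∑ i ∈ S, ∫ x, inner ℝ (grad n ρ x) (grad n (fun x => χ i x * η x) x)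
        ∂(riemannianVolume n M) := by
    rw [← integral_finsetSum _ fun i _ => integrable_inner_grad hρ (hχL i) (hχc i)]
    refine integral_congr_ae ?_
    -- The gradient is additive only at points of differentiability, whence the assumption `hηd`.
    filter_upwards [hηd] with x hx
    have hd : ∀ i ∈ S, MDifferentiableAt 𝓘(ℝ, EucSp n) 𝓘(ℝ, ℝ) (fun x => χ i x * η x) x := by
      intro i _
      have hχd : MDifferentiableAt 𝓘(ℝ, EucSp n) 𝓘(ℝ, ℝ) (χ i) x :=
        (χ i).contMDiff.mdifferentiable (by simp) x
      refine (inner_grad_comp₂ hχd hx (F := fun p => p.1 * p.2) (a := η x) (b := χ i x) ?_).1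
      have := (hasFDerivAt_fst (𝕜 := ℝ) (p := (χ i x, η x))).mul
        (hasFDerivAt_snd (𝕜 := ℝ) (p := (χ i x, η x)))
      rwa [add_comm] at this
    have h3 := inner_grad_sum S hd (grad n ρ x)
    have h4 : (fun y => ∑ i ∈ S, χ i y * η y) = η := funext fun y => (hsum y).symm
    rw [h4] at h3
    simp only [fun i => real_inner_comm (grad n (fun x => χ i x * η x) x) (grad n ρ x)]
    rw [real_inner_comm, h3]
  rw [h1, h2, ← Finset.sum_neg_distrib]
  exact Finset.sum_le_sum fun i _ => hpiece i

end LipschitzTestFunctions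

/-! ### Testing with powers of the weight -/

section WeightedTest

open Filter

variable {n : ℕ} {M : Type*} [TopologicalSpace M] [T2Space M] [SecondCountableTopology M]
  [ChartedSpace (EucSp n) M] [IsManifold 𝓘(ℝ, EucSp n) ∞ M]
  [RiemannianBundle (fun x : M => TangentSpace 𝓘(ℝ, EucSp n) x)]
  [IsContMDiffRiemannianBundle 𝓘(ℝ, EucSp n) ∞ (EucSp n)
      (fun x : M => TangentSpace 𝓘(ℝ, EucSp n) x)]
  [MeasurableSpace M] [BorelSpace M]

/-- A nonnegative function with unit gradient is positive almost everywhere. -/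
lemma ae_pos_of_norm_grad_eq_one {ρ : M → ℝ} (hρ0 : ∀ x, 0 ≤ ρ x)
    (hρ : ∀ᵐ x ∂(riemannianVolume n M), ‖grad n ρ x‖ = 1) :
    ∀ᵐ x ∂(riemannianVolume n M), 0 < ρ x := by
  filter_upwards [hρ] with x hx
  refine (hρ0 x).lt_of_ne fun h => ?_
  rw [grad_eq_zero_of_isLocalMin (Eventually.of_forall fun y => h ▸ hρ0 y), norm_zero] at hx
  exact zero_ne_one hx

/-- Translating the weight: if `Δρ ≥ C / ρ` then `Δρ ≥ C / (ρ + ε)`. -/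
lemma weak_inequality_add_const {ρ : M → ℝ} (hρ0 : ∀ x, 0 ≤ ρ x) (hρc : Continuous ρ)
    (hρ : ∀ᵐ x ∂(riemannianVolume n M), ‖grad n ρ x‖ = 1) {C : ℝ} (hC : 0 < C)
    (hΔ : LaplacianGE n ρ fun x => C / ρ x) {ε : ℝ} (hε : 0 < ε) {η : M → ℝ}
    (hη : ContMDiff 𝓘(ℝ, EucSp n) 𝓘(ℝ, ℝ) ∞ η) (hηc : HasCompactSupport η)
    (hη0 : ∀ x, 0 ≤ η x) :
    ∫ x, C / (ρ x + ε) * η x ∂(riemannianVolume n M) ≤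
      -∫ x, inner ℝ (grad n ρ x) (grad n η x) ∂(riemannianVolume n M) := by
  refine le_trans ?_ (hΔ.2 η hη hηc hη0)
  have hlc : LocallyCompactSpace M := ChartedSpace.locallyCompactSpace (EucSp n) M
  have hcf : Continuous fun x => C / (ρ x + ε) :=
    continuous_const.div (hρc.add continuous_const) fun x => by linarith [hρ0 x]
  refine integral_mono_ae
    ((hcf.mul hη.continuous).integrable_of_hasCompactSupport hηc.mul_left) ?_ ?_
  · have := hΔ.1.integrable_smul_right_of_hasCompactSupport hη.continuous hηc
    simpa only [smul_eq_mul] using this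
  -- Positivity of `ρ` matters: at a zero of `ρ` the quotient `C / ρ` is zero by convention and the
  -- comparison would fail.
  · filter_upwards [ae_pos_of_norm_grad_eq_one hρ0 hρ] with x hx
    exact mul_le_mul_of_nonneg_right
      (div_le_div_of_nonneg_left hC.le hx (by linarith)) (hη0 x)

/-- The shift `ε` keeps the weight away from its singularity, and `p > 1` makes `|t| ^ p`
continuously differentiable at zero. -/
lemma contDiffAt_weight_mul_power {s p ε : ℝ} (hp : 1 < p) (a b : ℝ) (hb : 0 < b + ε) :
    ContDiffAt ℝ 1 (fun z : ℝ × ℝ => (z.2 + ε) ^ s * |z.1| ^ p) (a, b) := by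
  have h1 : ContDiffAt ℝ 1 (fun z : ℝ × ℝ => (z.2 + ε) ^ s) (a, b) :=
    (contDiffAt_snd.add contDiffAt_const).rpow_const_of_ne hb.ne'
  have h2 : ContDiff ℝ 1 (fun z : ℝ × ℝ => |z.1| ^ p) := by
    simpa only [Real.norm_eq_abs] using (contDiff_fst (𝕜 := ℝ) (E := ℝ) (F := ℝ)).norm_rpow hp
  exact h1.mul h2.contDiffAt

lemma hasFDerivAt_weight_mul_power {s p ε : ℝ} (hp : 1 < p) (a b : ℝ) (hb : 0 < b + ε) :
    HasFDerivAt (fun z : ℝ × ℝ => (z.2 + ε) ^ s * |z.1| ^ p)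
      (((b + ε) ^ s * (p * |a| ^ (p - 2) * a)) • ContinuousLinearMap.fst ℝ ℝ ℝ +
        (s * (b + ε) ^ (s - 1) * |a| ^ p) • ContinuousLinearMap.snd ℝ ℝ ℝ) (a, b) := by
  have h1 : HasDerivAt (fun t : ℝ => (t + ε) ^ s) (s * (b + ε) ^ (s - 1)) b := by
    have := ((hasDerivAt_id b).add_const ε).rpow_const (p := s) (Or.inl hb.ne')
    simpa using this
  have h1' := h1.comp_hasFDerivAt (a, b) (hasFDerivAt_snd (𝕜 := ℝ) (p := (a, b)))
  have h2' := (hasDerivAt_abs_rpow a hp).comp_hasFDerivAt (a, b)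
    (hasFDerivAt_fst (𝕜 := ℝ) (p := (a, b)))
  refine (h1'.mul h2').congr_fderiv ?_
  ext
  · simp
  · simp [mul_comm]

/-- Testing `Δρ ≥ C / (ρ + ε)` with `(ρ + ε) ^ s * |φ| ^ p`. -/
theorem weighted_power_test {ρ : M → ℝ} (hρ0 : ∀ x, 0 ≤ ρ x) (hρL : ChartLipschitz n ρ)
    (hρ : ∀ᵐ x ∂(riemannianVolume n M), ‖grad n ρ x‖ = 1) {C : ℝ} (hC : 0 < C)
    (hΔ : LaplacianGE n ρ fun x => C / ρ x) {ε : ℝ} (hε : 0 < ε) {φ : M → ℝ}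
    (hφ : ContMDiff 𝓘(ℝ, EucSp n) 𝓘(ℝ, ℝ) ∞ φ) (hφc : HasCompactSupport φ)
    {p : ℝ} (hp : 1 < p) (s : ℝ) :
    Integrable (fun x => (ρ x + ε) ^ (s - 1) * |φ x| ^ p) (riemannianVolume n M) ∧
    Integrable (fun x => (ρ x + ε) ^ s * (p * |φ x| ^ (p - 2) * φ x) *
      inner ℝ (grad n φ x) (grad n ρ x)) (riemannianVolume n M) ∧
    (C + s) * ∫ x, (ρ x + ε) ^ (s - 1) * |φ x| ^ p ∂(riemannianVolume n M) ≤
      -∫ x, (ρ x + ε) ^ s * (p * |φ x| ^ (p - 2) * φ x) *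
        inner ℝ (grad n φ x) (grad n ρ x) ∂(riemannianVolume n M) := by
  have hr : ∀ x, 0 < ρ x + ε := fun x => by linarith [hρ0 x]
  have hφL : ChartLipschitz n φ := chartLipschitz_of_contMDiff hφ
  set η : M → ℝ := fun x => (ρ x + ε) ^ s * |φ x| ^ p with hη
  have hηL : ChartLipschitz n η := hφL.comp₂ hρL
    (F := fun z : ℝ × ℝ => (z.2 + ε) ^ s * |z.1| ^ p)
    fun x => contDiffAt_weight_mul_power hp _ _ (hr x)
  have hφp : HasCompactSupport fun x => |φ x| ^ p := by
    refine HasCompactSupport.intro hφc fun x hx => ?_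
    rw [image_eq_zero_of_notMem_tsupport hx, abs_zero, Real.zero_rpow (by linarith)]
  have hηc : HasCompactSupport η := hφp.mul_left
  have hd : ∀ᵐ x ∂(riemannianVolume n M),
      MDifferentiableAt 𝓘(ℝ, EucSp n) 𝓘(ℝ, ℝ) η x ∧ ∀ w, inner ℝ (grad n η x) w =
        (ρ x + ε) ^ s * (p * |φ x| ^ (p - 2) * φ x) * inner ℝ (grad n φ x) w +
        s * (ρ x + ε) ^ (s - 1) * |φ x| ^ p * inner ℝ (grad n ρ x) w := by
    filter_upwards [hρ] with x hx
    have hρd : MDifferentiableAt 𝓘(ℝ, EucSp n) 𝓘(ℝ, ℝ) ρ x :=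
      mdifferentiableAt_of_grad_ne_zero fun h => by simp [h] at hx
    exact inner_grad_comp₂ (hφ.mdifferentiable (by simp) x) hρd
      (F := fun z : ℝ × ℝ => (z.2 + ε) ^ s * |z.1| ^ p)
      (hasFDerivAt_weight_mul_power hp _ _ (hr x))
  have hcf : Continuous fun x => C / (ρ x + ε) :=
    continuous_const.div (hρL.continuous.add continuous_const) fun x => (hr x).ne'
  have key := weak_inequality_of_chartLipschitz hcf hρ
    (fun η hη hηc hη0 => weak_inequality_add_const hρ0 hρL.continuous hρ hC hΔ hε hη hηc hη0)
    (fun x => mul_nonneg (Real.rpow_nonneg (hr x).le _) (Real.rpow_nonneg (abs_nonneg _) _))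
    hηc hηL (hd.mono fun x hx => hx.1)
  have hI1 : Integrable (fun x => (ρ x + ε) ^ (s - 1) * |φ x| ^ p) (riemannianVolume n M) := by
    refine Continuous.integrable_of_hasCompactSupport ?_ hφp.mul_left
    refine Continuous.mul ?_ ?_
    · exact (hρL.continuous.add continuous_const).rpow_const fun x => Or.inl (hr x).ne'
    · exact hφL.continuous.abs.rpow_const fun x => Or.inr (by linarith)
  have hIη := integrable_inner_grad hρ hηL hηc
  -- Because `|∇ρ|² = 1`, differentiating the weight contributes exactly `s` times the integral
  -- already on the left. This turns `C` into `C + s`.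
  have hae : (fun x => inner ℝ (grad n ρ x) (grad n η x) - s * ((ρ x + ε) ^ (s - 1) * |φ x| ^ p))
      =ᵐ[riemannianVolume n M] fun x => (ρ x + ε) ^ s * (p * |φ x| ^ (p - 2) * φ x) *
        inner ℝ (grad n φ x) (grad n ρ x) := by
    filter_upwards [hd, hρ] with x hx h1
    rw [real_inner_comm, hx.2, real_inner_self_eq_norm_sq, h1]
    ring
  have hI2 := (hIη.sub (hI1.const_mul s)).congr hae
  refine ⟨hI1, hI2, ?_⟩
  rw [← integral_congr_ae hae, integral_sub hIη (hI1.const_mul s), integral_const_mul]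
  have h1 : ∫ x, C / (ρ x + ε) * η x ∂(riemannianVolume n M) =
      C * ∫ x, (ρ x + ε) ^ (s - 1) * |φ x| ^ p ∂(riemannianVolume n M) := by
    rw [← integral_const_mul]
    refine integral_congr_ae (ae_of_all _ fun x => ?_)
    simp only [hη]
    rw [Real.rpow_sub_one (hr x).ne']
    ring
  rw [h1] at key
  linarith

end WeightedTest

/-! ### Hölder estimates and lower limits -/

section Hoelder

open Filter

variable {α : Type*} [MeasurableSpace α] {ν : Measure α}

/-- Absorbing a Hölder pairing: `c ‖Q‖_q ^ q ≤ q ∫ Q ^ (q - 1) P` implies `‖Q‖_q ≤ (q / c) ‖P‖_q`. -/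
lemma Lq_le_of_mul_lintegral_le {q c : ℝ} (hq : 1 < q) (hc : 0 < c) {P Q : α → ℝ≥0∞}
    (hP : AEMeasurable P ν) (hQ : AEMeasurable Q ν) (hfin : ∫⁻ x, Q x ^ q ∂ν ≠ ⊤)
    (h : ENNReal.ofReal c * ∫⁻ x, Q x ^ q ∂ν ≤
      ENNReal.ofReal q * ∫⁻ x, Q x ^ (q - 1) * P x ∂ν) :
    (∫⁻ x, Q x ^ q ∂ν) ^ (1 / q) ≤
      ENNReal.ofReal (q / c) * (∫⁻ x, P x ^ q ∂ν) ^ (1 / q) := by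
  set a := ∫⁻ x, Q x ^ q ∂ν with ha
  set b := ∫⁻ x, P x ^ q ∂ν with hb
  have hq0 : 0 < q := by linarith
  rcases eq_or_ne a 0 with h0 | h0
  · rw [h0, ENNReal.zero_rpow_of_pos (by positivity)]; exact zero_le
  have hconj : (q / (q - 1)).HolderConjugate q := (Real.HolderConjugate.conjExponent hq).symm
  have hH := ENNReal.lintegral_mul_le_Lp_mul_Lq ν hconj (hQ.pow_const (q - 1)) hP
  have hpow : ∀ x, (Q x ^ (q - 1)) ^ (q / (q - 1)) = Q x ^ q := fun x => by
    rw [← ENNReal.rpow_mul, mul_div_cancel₀ _ (by linarith : q - 1 ≠ 0)]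
  simp only [hpow, Pi.mul_apply] at hH
  have hexp : 1 / (q / (q - 1)) = 1 - 1 / q := by
    field_simp
  rw [hexp] at hH
  have h1 : ENNReal.ofReal c * a ≤ ENNReal.ofReal q * (a ^ (1 - 1 / q) * b ^ (1 / q)) :=
    h.trans (mul_le_mul_right hH _)
  -- Cancelling the factor `a ^ (1 - 1 / q)` needs `0 < a < ⊤`; the finiteness is what the
  -- regularisation of the weight supplies.
  have hsplit : a = a ^ (1 - 1 / q) * a ^ (1 / q) := by
    rw [← ENNReal.rpow_add _ _ h0 hfin]; simp
  have hu0 : a ^ (1 - 1 / q) ≠ 0 := (ENNReal.rpow_pos (pos_iff_ne_zero.2 h0) hfin).ne'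
  have hut : a ^ (1 - 1 / q) ≠ ⊤ := ENNReal.rpow_ne_top_of_nonneg
    (by rw [sub_nonneg, div_le_one hq0]; exact hq.le) hfin
  have h2 : ENNReal.ofReal c * a ^ (1 / q) ≤ ENNReal.ofReal q * b ^ (1 / q) := by
    rw [← ENNReal.mul_le_mul_iff_right hu0 hut]
    calc a ^ (1 - 1 / q) * (ENNReal.ofReal c * a ^ (1 / q))
        = ENNReal.ofReal c * (a ^ (1 - 1 / q) * a ^ (1 / q)) := by ring
      _ ≤ ENNReal.ofReal q * (a ^ (1 - 1 / q) * b ^ (1 / q)) := by rw [← hsplit]; exact h1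
      _ = _ := by ring
  rw [ENNReal.ofReal_div_of_pos hc, ENNReal.div_eq_inv_mul, mul_assoc]
  have hc0 : ENNReal.ofReal c ≠ 0 := by simpa using hc
  rw [← ENNReal.mul_le_mul_iff_right hc0 ENNReal.ofReal_ne_top, ← mul_assoc,
    ENNReal.mul_inv_cancel hc0 ENNReal.ofReal_ne_top, one_mul]
  exact h2

/-- The remainder estimate: if `R ≤ P + κ Q` and `Q` is controlled by `P` through
`Lq_le_of_mul_lintegral_le`, then `‖R‖_q² ≤ K² ν(univ) ^ (2 / q - 1) ‖P‖_2²`. -/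
lemma sq_Lq_le_sq_L2 {q c κ : ℝ} (hq : 1 < q) (hq2 : q ≤ 2) (hc : 0 < c) (hκ : 0 ≤ κ)
    {P Q R : α → ℝ≥0∞}
    (hP : AEMeasurable P ν) (hQ : AEMeasurable Q ν) (hfin : ∫⁻ x, Q x ^ q ∂ν ≠ ⊤)
    (h : ENNReal.ofReal c * ∫⁻ x, Q x ^ q ∂ν ≤
      ENNReal.ofReal q * ∫⁻ x, Q x ^ (q - 1) * P x ∂ν)
    (hR : ∀ᵐ x ∂ν, R x ≤ P x + ENNReal.ofReal κ * Q x) :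
    (∫⁻ x, R x ^ q ∂ν) ^ (2 / q) ≤
      ENNReal.ofReal ((1 + κ * (q / c)) ^ 2) * ν univ ^ (2 / q - 1) * ∫⁻ x, P x ^ (2 : ℝ) ∂ν := by
  have hq0 : 0 < q := by linarith
  have h1 : (∫⁻ x, R x ^ q ∂ν) ^ (1 / q) ≤
      (∫⁻ x, P x ^ q ∂ν) ^ (1 / q) + ENNReal.ofReal κ * (∫⁻ x, Q x ^ q ∂ν) ^ (1 / q) := by
    have h2 : (∫⁻ x, R x ^ q ∂ν) ^ (1 / q) ≤
        (∫⁻ x, (P + fun x => ENNReal.ofReal κ * Q x) x ^ q ∂ν) ^ (1 / q) := by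
      refine ENNReal.rpow_le_rpow (lintegral_mono_ae (hR.mono fun x hx => ?_)) (by positivity)
      exact ENNReal.rpow_le_rpow hx hq0.le
    refine h2.trans ((ENNReal.lintegral_Lp_add_le hP (hQ.const_mul _) hq.le).trans_eq ?_)
    congr 1
    have h3 : ∀ x, (ENNReal.ofReal κ * Q x) ^ q = ENNReal.ofReal κ ^ q * Q x ^ q := fun x =>
      ENNReal.mul_rpow_of_nonneg _ _ hq0.le
    simp only [h3]
    rw [lintegral_const_mul'' _ (hQ.pow_const q), ENNReal.mul_rpow_of_nonneg _ _ (by positivity),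
      ← ENNReal.rpow_mul, mul_one_div_cancel hq0.ne', ENNReal.rpow_one]
  have h4 : (∫⁻ x, R x ^ q ∂ν) ^ (1 / q) ≤
      ENNReal.ofReal (1 + κ * (q / c)) * (∫⁻ x, P x ^ q ∂ν) ^ (1 / q) := by
    refine h1.trans ?_
    rw [ENNReal.ofReal_add zero_le_one (by positivity), ENNReal.ofReal_one, add_mul, one_mul,
      ENNReal.ofReal_mul hκ, mul_assoc]
    gcongr
    exact Lq_le_of_mul_lintegral_le hq hc hP hQ hfin h
  have h5 : (∫⁻ x, P x ^ q ∂ν) ^ (1 / q) ≤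
      (∫⁻ x, P x ^ (2 : ℝ) ∂ν) ^ (1 / (2 : ℝ)) * ν univ ^ (1 / q - 1 / 2) := by
    have := eLpNorm'_le_eLpNorm'_mul_rpow_measure_univ (μ := ν) hq0 hq2 hP.aestronglyMeasurable
    simpa only [eLpNorm'_eq_lintegral_enorm, enorm_eq_self] using this
  have hsq : ∀ y : ℝ≥0∞, y ^ (2 / q) = (y ^ (1 / q)) ^ (2 : ℝ) := fun y => by
    rw [← ENNReal.rpow_mul]; congr 1; ring
  rw [hsq]
  refine (ENNReal.rpow_le_rpow (h4.trans (mul_le_mul_right h5 _)) zero_le_two).trans_eq ?_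
  rw [ENNReal.mul_rpow_of_nonneg _ _ zero_le_two, ENNReal.mul_rpow_of_nonneg _ _ zero_le_two,
    ← ENNReal.rpow_mul, ← ENNReal.rpow_mul, ENNReal.ofReal_rpow_of_nonneg (by positivity) zero_le_two,
    Real.rpow_two]
  rw [show 1 / (2 : ℝ) * 2 = 1 by norm_num, ENNReal.rpow_one,
    show (1 / q - 1 / 2) * 2 = 2 / q - 1 by ring]
  ring

/-- Lower limits of an inequality `c₁ b + c₂ d ^ t ≤ a`. -/
lemma mul_liminf_add_le_liminf {a b d : ℕ → ℝ≥0∞} {c₁ c₂ : ℝ≥0∞} (h₁ : c₁ ≠ ⊤) (h₂ : c₂ ≠ ⊤)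
    {t : ℝ} (ht : 0 < t) (h : ∀ k, c₁ * b k + c₂ * d k ^ t ≤ a k) :
    c₁ * liminf b atTop + c₂ * (liminf d atTop) ^ t ≤ liminf a atTop := by
  have hcont : Continuous fun z : ℝ≥0∞ × ℝ≥0∞ => c₁ * z.1 + c₂ * z.2 ^ t :=
    ((ENNReal.continuous_const_mul h₁).comp continuous_fst).add
      ((ENNReal.continuous_const_mul h₂).comp (ENNReal.continuous_rpow_const.comp continuous_snd))
  -- A lower limit is the limit of the tail infima, and the inequality holds for these; continuity
  -- of the left side then passes to the limit.
  have hmono : ∀ u : ℕ → ℝ≥0∞, Tendsto (fun N => ⨅ k ≥ N, u k) atTop (𝓝 (liminf u atTop)) := by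
    intro u
    rw [liminf_eq_iSup_iInf_of_nat]
    exact tendsto_atTop_iSup fun N N' hN => le_iInf₂ fun k hk => iInf₂_le k (hN.trans hk)
  have h3 := (hcont.tendsto (liminf b atTop, liminf d atTop)).comp
    ((hmono b).prodMk_nhds (hmono d))
  refine le_of_tendsto_of_tendsto' h3 (hmono a) fun N => le_iInf₂ fun k hk => ?_
  refine le_trans ?_ (h k)
  simp only [Function.comp_apply]
  gcongr
  · exact iInf₂_le k hk
  · exact iInf₂_le k hk

end Hoelder

/-! ### The two Hardy inequalities for the regularised weight -/

section Hardy

open Filter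

variable {n : ℕ} {M : Type*} [TopologicalSpace M] [T2Space M] [SecondCountableTopology M]
  [ChartedSpace (EucSp n) M] [IsManifold 𝓘(ℝ, EucSp n) ∞ M]
  [RiemannianBundle (fun x : M => TangentSpace 𝓘(ℝ, EucSp n) x)]
  [IsContMDiffRiemannianBundle 𝓘(ℝ, EucSp n) ∞ (EucSp n)
      (fun x : M => TangentSpace 𝓘(ℝ, EucSp n) x)]
  [MeasurableSpace M] [BorelSpace M]

lemma aemeasurable_norm_grad (u : M → ℝ) :
    AEMeasurable (fun x => ‖grad n u x‖) (riemannianVolume n M) := by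
  have h := (aemeasurable_inner_grad (n := n) u u).sqrt
  refine h.congr (ae_of_all _ fun x => ?_)
  simp only [real_inner_self_eq_norm_sq]
  exact Real.sqrt_sq (norm_nonneg _)

variable (n) in
/-- The gradient of the ground state transform `ψ = (ρ + ε) ^ κ φ`, up to the factor
`(ρ + ε) ^ κ`. -/
def shiftedGrad (κ ε : ℝ) (ρ φ : M → ℝ) (x : M) : TangentSpace 𝓘(ℝ, EucSp n) x :=
  grad n φ x + (κ * φ x / (ρ x + ε)) • grad n ρ x

lemma norm_shiftedGrad_sq (κ ε : ℝ) (ρ φ : M → ℝ) (x : M) :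
    ‖shiftedGrad n κ ε ρ φ x‖ ^ 2 = ‖grad n φ x‖ ^ 2 +
      2 * (κ * φ x / (ρ x + ε)) * inner ℝ (grad n φ x) (grad n ρ x) +
      (κ * φ x / (ρ x + ε)) ^ 2 * ‖grad n ρ x‖ ^ 2 := by
  rw [shiftedGrad, norm_add_sq_real, inner_smul_right, norm_smul, mul_pow, Real.norm_eq_abs, sq_abs]
  ring

lemma aemeasurable_norm_shiftedGrad {ρ φ : M → ℝ} (hρ : Continuous ρ) (hφ : Continuous φ)
    (κ ε : ℝ) : AEMeasurable (fun x => ‖shiftedGrad n κ ε ρ φ x‖) (riemannianVolume n M) := by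
  have hm : AEMeasurable (fun x => κ * φ x / (ρ x + ε)) (riemannianVolume n M) :=
    ((hφ.measurable.const_mul κ).div (hρ.measurable.add_const ε)).aemeasurable
  have h : AEMeasurable (fun x => ‖grad n φ x‖ ^ 2 +
      2 * (κ * φ x / (ρ x + ε)) * inner ℝ (grad n φ x) (grad n ρ x) +
      (κ * φ x / (ρ x + ε)) ^ 2 * ‖grad n ρ x‖ ^ 2) (riemannianVolume n M) :=
    (((aemeasurable_norm_grad φ).pow_const 2).add
      ((hm.const_mul 2).mul (aemeasurable_inner_grad φ ρ))).add
      ((hm.pow_const 2).mul ((aemeasurable_norm_grad ρ).pow_const 2))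
  refine h.sqrt.congr (ae_of_all _ fun x => ?_)
  simp only
  rw [← norm_shiftedGrad_sq, Real.sqrt_sq (norm_nonneg _)]

lemma integrable_weight_mul_norm_grad_sq {ρ φ : M → ℝ} (hρ0 : ∀ x, 0 ≤ ρ x) (hρ : Continuous ρ)
    {ε : ℝ} (hε : 0 < ε) (hφ : ContMDiff 𝓘(ℝ, EucSp n) 𝓘(ℝ, ℝ) ∞ φ) (hφc : HasCompactSupport φ)
    (α : ℝ) :
    Integrable (fun x => (ρ x + ε) ^ α * ‖grad n φ x‖ ^ 2) (riemannianVolume n M) := by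
  have hcont : Continuous fun x => (ρ x + ε) ^ α :=
    (hρ.add continuous_const).rpow_const fun x =>
      Or.inl (add_pos_of_nonneg_of_pos (hρ0 x) hε).ne'
  obtain ⟨B, hB⟩ := (chartLipschitz_of_contMDiff hφ).exists_norm_grad_le (n := n) hφc
  obtain ⟨D, hD⟩ := IsCompact.exists_bound_of_continuousOn hφc hcont.continuousOn
  refine (integrable_indicator_const_of_isCompact (n := n) hφc (D * B ^ 2)).mono'
    (hcont.aemeasurable.mul ((aemeasurable_norm_grad φ).pow_const 2)).aestronglyMeasurable
    (ae_of_all _ fun x => ?_)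
  by_cases hx : x ∈ tsupport φ
  · rw [indicator_of_mem hx, norm_mul, norm_pow, norm_norm]
    exact mul_le_mul (hD x hx) (pow_le_pow_left₀ (norm_nonneg _) (hB x hx) 2) (by positivity)
      ((norm_nonneg _).trans (hD x hx))
  · rw [indicator_of_notMem hx, grad_eq_zero_of_notMem_tsupport hx]
    simp

/-- The weighted Hardy inequality with its exact remainder, for the regularised weight. -/
theorem hardy_shifted {ρ : M → ℝ} (hρ0 : ∀ x, 0 ≤ ρ x) (hρL : ChartLipschitz n ρ)
    (hρ : ∀ᵐ x ∂(riemannianVolume n M), ‖grad n ρ x‖ = 1) {C : ℝ} (hC : 0 < C)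
    (hΔ : LaplacianGE n ρ fun x => C / ρ x) {ε : ℝ} (hε : 0 < ε) {φ : M → ℝ}
    (hφ : ContMDiff 𝓘(ℝ, EucSp n) 𝓘(ℝ, ℝ) ∞ φ) (hφc : HasCompactSupport φ) {α κ : ℝ}
    (hκ : 0 < κ) (hκC : 2 * κ = C + α - 1) :
    ENNReal.ofReal (κ ^ 2) *
        ∫⁻ x, ENNReal.ofReal ((ρ x + ε) ^ α * (φ x ^ 2 / (ρ x + ε) ^ 2)) ∂(riemannianVolume n M) +
      ∫⁻ x, ENNReal.ofReal ((ρ x + ε) ^ α * ‖shiftedGrad n κ ε ρ φ x‖ ^ 2)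
        ∂(riemannianVolume n M) ≤
      ∫⁻ x, ENNReal.ofReal ((ρ x + ε) ^ α * ‖grad n φ x‖ ^ 2) ∂(riemannianVolume n M) := by
  have hr : ∀ x, 0 < ρ x + ε := fun x => by linarith [hρ0 x]
  obtain ⟨hI1, hI2, hI⟩ := weighted_power_test hρ0 hρL hρ hC hΔ hε hφ hφc one_lt_two (α - 1)
  have hI3 := integrable_weight_mul_norm_grad_sq hρ0 hρL.continuous hε hφ hφc α
  have hA : ∀ x, (ρ x + ε) ^ (α - 1 - 1) * |φ x| ^ (2 : ℝ) =
      (ρ x + ε) ^ α * (φ x ^ 2 / (ρ x + ε) ^ 2) := by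
    intro x
    rw [Real.rpow_sub_one (hr x).ne', Real.rpow_sub_one (hr x).ne', Real.rpow_two, sq_abs]
    field_simp
  -- Expanding the square: the cross term is `κ` times the integrand produced by the test with `p =
  -- 2`, `s = α - 1`.
  have hae : (fun x => (ρ x + ε) ^ α * ‖grad n φ x‖ ^ 2 +
      κ * ((ρ x + ε) ^ (α - 1) * (2 * |φ x| ^ ((2 : ℝ) - 2) * φ x) *
        inner ℝ (grad n φ x) (grad n ρ x)) +
      κ ^ 2 * ((ρ x + ε) ^ (α - 1 - 1) * |φ x| ^ (2 : ℝ)))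
      =ᵐ[riemannianVolume n M] fun x => (ρ x + ε) ^ α * ‖shiftedGrad n κ ε ρ φ x‖ ^ 2 := by
    filter_upwards [hρ] with x hx
    rw [norm_shiftedGrad_sq, hx, hA, sub_self, Real.rpow_zero, Real.rpow_sub_one (hr x).ne']
    have := (hr x).ne'
    field_simp
  have hI32 : Integrable (fun x => (ρ x + ε) ^ α * ‖grad n φ x‖ ^ 2 +
      κ * ((ρ x + ε) ^ (α - 1) * (2 * |φ x| ^ ((2 : ℝ) - 2) * φ x) *
        inner ℝ (grad n φ x) (grad n ρ x))) (riemannianVolume n M) := hI3.add (hI2.const_mul κ)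
  have hIX := (hI32.add (hI1.const_mul (κ ^ 2))).congr hae
  have hint := integral_congr_ae hae
  rw [integral_add hI32 (hI1.const_mul (κ ^ 2)),
    integral_add hI3 (hI2.const_mul κ), integral_const_mul, integral_const_mul] at hint
  simp only [← hA]
  have hA0 : ∀ x, 0 ≤ (ρ x + ε) ^ (α - 1 - 1) * |φ x| ^ (2 : ℝ) := fun x =>
    mul_nonneg (Real.rpow_nonneg (hr x).le _) (Real.rpow_nonneg (abs_nonneg _) _)
  have hX0 : ∀ x, 0 ≤ (ρ x + ε) ^ α * ‖shiftedGrad n κ ε ρ φ x‖ ^ 2 := fun x =>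
    mul_nonneg (Real.rpow_nonneg (hr x).le _) (sq_nonneg _)
  rw [← ofReal_integral_eq_lintegral_ofReal hI1 (ae_of_all _ hA0),
    ← ofReal_integral_eq_lintegral_ofReal hIX (ae_of_all _ hX0),
    ← ofReal_integral_eq_lintegral_ofReal hI3 (ae_of_all _ fun x =>
      mul_nonneg (Real.rpow_nonneg (hr x).le _) (sq_nonneg _)),
    ← ENNReal.ofReal_mul (sq_nonneg _),
    ← ENNReal.ofReal_add (mul_nonneg (sq_nonneg _) (integral_nonneg hA0)) (integral_nonneg hX0)]
  refine ENNReal.ofReal_le_ofReal ?_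
  -- The cross term is at most `-2 κ²` times the Hardy integral. With the `+κ²` of the expansion,
  -- `-κ²` remains.
  have h2 : C + (α - 1) = 2 * κ := by linarith
  rw [h2] at hI
  have h3 := mul_le_mul_of_nonneg_left hI hκ.le
  rw [← hint]
  nlinarith

/-- The `L^q` Hardy inequality for the ground state transform, for the regularised weight. -/
theorem hardy_Lq_shifted {ρ : M → ℝ} (hρ0 : ∀ x, 0 ≤ ρ x) (hρL : ChartLipschitz n ρ)
    (hρ : ∀ᵐ x ∂(riemannianVolume n M), ‖grad n ρ x‖ = 1) {C : ℝ} (hC : 0 < C)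
    (hΔ : LaplacianGE n ρ fun x => C / ρ x) {ε : ℝ} (hε : 0 < ε) {φ : M → ℝ}
    (hφ : ContMDiff 𝓘(ℝ, EucSp n) 𝓘(ℝ, ℝ) ∞ φ) (hφc : HasCompactSupport φ) {α κ q : ℝ}
    (hκC : 2 * κ = C + α - 1) (hq : 1 < q) (hq2 : q < 2) :
    (∫⁻ x, ENNReal.ofReal ((ρ x + ε) ^ (α / 2 - 1) * |φ x|) ^ q ∂(riemannianVolume n M) ≠ ⊤) ∧
    ENNReal.ofReal ((1 + C) * (1 - q / 2)) *
        ∫⁻ x, ENNReal.ofReal ((ρ x + ε) ^ (α / 2 - 1) * |φ x|) ^ q ∂(riemannianVolume n M) ≤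
      ENNReal.ofReal q *
        ∫⁻ x, ENNReal.ofReal ((ρ x + ε) ^ (α / 2 - 1) * |φ x|) ^ (q - 1) *
          ENNReal.ofReal ((ρ x + ε) ^ (α / 2) * ‖shiftedGrad n κ ε ρ φ x‖)
            ∂(riemannianVolume n M) := by
  have hr : ∀ x, 0 < ρ x + ε := fun x => by linarith [hρ0 x]
  have hq0 : 0 < q := by linarith
  -- Chosen so that `s - 1 = q (α / 2 - 1)`: the integral gained from the test is then that of `Q ^
  -- q`.
  set s := q * α / 2 - q + 1 with hs
  obtain ⟨hI1, hI2, hI⟩ := weighted_power_test hρ0 hρL hρ hC hΔ hε hφ hφc hq s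
  have hQ0 : ∀ x, 0 ≤ (ρ x + ε) ^ (α / 2 - 1) * |φ x| := fun x =>
    mul_nonneg (Real.rpow_nonneg (hr x).le _) (abs_nonneg _)
  have hQq : ∀ x, ENNReal.ofReal ((ρ x + ε) ^ (α / 2 - 1) * |φ x|) ^ q =
      ENNReal.ofReal ((ρ x + ε) ^ (s - 1) * |φ x| ^ q) := by
    intro x
    rw [ENNReal.ofReal_rpow_of_nonneg (hQ0 x) hq0.le,
      Real.mul_rpow (Real.rpow_nonneg (hr x).le _) (abs_nonneg _), ← Real.rpow_mul (hr x).le]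
    congr 3
    rw [hs]; ring
  have hA0 : ∀ x, 0 ≤ (ρ x + ε) ^ (s - 1) * |φ x| ^ q := fun x =>
    mul_nonneg (Real.rpow_nonneg (hr x).le _) (Real.rpow_nonneg (abs_nonneg _) _)
  have hQP : ∀ x, ENNReal.ofReal ((ρ x + ε) ^ (α / 2 - 1) * |φ x|) ^ (q - 1) *
      ENNReal.ofReal ((ρ x + ε) ^ (α / 2) * ‖shiftedGrad n κ ε ρ φ x‖) =
      ENNReal.ofReal ((ρ x + ε) ^ s * |φ x| ^ (q - 1) * ‖shiftedGrad n κ ε ρ φ x‖) := by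
    intro x
    rw [ENNReal.ofReal_rpow_of_nonneg (hQ0 x) (by linarith),
      ← ENNReal.ofReal_mul (Real.rpow_nonneg (hQ0 x) _),
      Real.mul_rpow (Real.rpow_nonneg (hr x).le _) (abs_nonneg _), ← Real.rpow_mul (hr x).le]
    congr 1
    have : (ρ x + ε) ^ s = (ρ x + ε) ^ ((α / 2 - 1) * (q - 1)) * (ρ x + ε) ^ (α / 2) := by
      rw [← Real.rpow_add (hr x)]
      congr 1
      rw [hs]; ring
    rw [this]; ring
  simp only [hQq, hQP]
  have hfin := ofReal_integral_eq_lintegral_ofReal hI1 (ae_of_all _ hA0)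
  refine ⟨by rw [← hfin]; exact ENNReal.ofReal_ne_top, ?_⟩
  set H : M → ℝ := fun x => -((ρ x + ε) ^ s * (q * |φ x| ^ (q - 2) * φ x) *
    inner ℝ (grad n φ x) (grad n ρ x)) - q * κ * ((ρ x + ε) ^ (s - 1) * |φ x| ^ q) with hH
  have hHI : Integrable H (riemannianVolume n M) := hI2.neg.sub (hI1.const_mul (q * κ))
  have hle : (1 + C) * (1 - q / 2) * ∫ x, (ρ x + ε) ^ (s - 1) * |φ x| ^ q ∂(riemannianVolume n M)
      ≤ ∫ x, H x ∂(riemannianVolume n M) := by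
    have h1 : ∫ x, H x ∂(riemannianVolume n M) = _ :=
      integral_sub hI2.neg (hI1.const_mul (q * κ))
    rw [h1, integral_const_mul]
    rw [integral_neg]
    -- The terms in `α` cancel in `C + s - q κ`, and what is left is positive because `q < 2`.
    have h2 : (1 + C) * (1 - q / 2) = C + s - q * κ := by
      rw [hs]; linear_combination (q / 2) * hκC
    rw [h2, sub_mul]
    linarith
  have hHle : ∀ᵐ x ∂(riemannianVolume n M), H x ≤
      q * ((ρ x + ε) ^ s * |φ x| ^ (q - 1) * ‖shiftedGrad n κ ε ρ φ x‖) := by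
    filter_upwards [hρ] with x hx
    set X := shiftedGrad n κ ε ρ φ x with hX
    have hin : inner ℝ (grad n φ x) (grad n ρ x) =
        inner ℝ X (grad n ρ x) - κ * φ x / (ρ x + ε) := by
      rw [hX, shiftedGrad, inner_add_left, real_inner_smul_left, real_inner_self_eq_norm_sq, hx]
      ring
    have habs : |inner ℝ X (grad n ρ x)| ≤ ‖X‖ := by
      simpa [hx] using abs_real_inner_le_norm X (grad n ρ x)
    have hpow : |φ x| ^ (q - 2) * φ x * φ x = |φ x| ^ q := by
      rcases eq_or_ne (φ x) 0 with h0 | h0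
      · simp [h0, Real.zero_rpow hq0.ne']
      · rw [mul_assoc, ← sq, ← sq_abs, ← Real.rpow_natCast, ← Real.rpow_add (abs_pos.2 h0)]
        norm_num
    have hpow1 : |φ x| ^ (q - 2) * |φ x| = |φ x| ^ (q - 1) := by
      rcases eq_or_ne (φ x) 0 with h0 | h0
      · simp [h0, Real.zero_rpow (by linarith : q - 1 ≠ 0)]
      · rw [← Real.rpow_add_one (abs_pos.2 h0).ne']; congr 1; ring
    have hs1 : (ρ x + ε) ^ (s - 1) = (ρ x + ε) ^ s / (ρ x + ε) := Real.rpow_sub_one (hr x).ne' _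
    -- The subtracted multiple of `q κ` is the contribution of the shift, so only the pairing of `X`
    -- with the unit vector `∇ρ` survives.
    have hH2 : H x = -((ρ x + ε) ^ s * q * (|φ x| ^ (q - 2) * φ x * inner ℝ X (grad n ρ x))) := by
      simp only [hH]
      rw [hin, hs1, ← hpow]
      have := (hr x).ne'
      field_simp
      ring
    rw [hH2, ← hpow1]
    have h5 : -(|φ x| ^ (q - 2) * φ x * inner ℝ X (grad n ρ x)) ≤
        |φ x| ^ (q - 2) * |φ x| * ‖X‖ := by
      refine (neg_le_abs _).trans ?_
      rw [abs_mul, abs_mul, abs_of_nonneg (Real.rpow_nonneg (abs_nonneg (φ x)) _)]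
      gcongr
    have h6 : 0 ≤ (ρ x + ε) ^ s * q := mul_nonneg (Real.rpow_nonneg (hr x).le _) hq0.le
    nlinarith [mul_le_mul_of_nonneg_left h5 h6]
  rw [← hfin, ← ENNReal.ofReal_mul (mul_nonneg (by linarith) (by linarith))]
  -- The positive part of `H` allows the passage to a `lintegral` without knowing that the upper
  -- bound is integrable.
  calc _ ≤ ENNReal.ofReal (∫ x, max (H x) 0 ∂(riemannianVolume n M)) :=
        ENNReal.ofReal_le_ofReal (hle.trans
          (integral_mono hHI hHI.pos_part fun x => le_max_left _ _))
    _ = ∫⁻ x, ENNReal.ofReal (max (H x) 0) ∂(riemannianVolume n M) :=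
        ofReal_integral_eq_lintegral_ofReal hHI.pos_part (ae_of_all _ fun x => le_max_right _ _)
    _ ≤ ∫⁻ x, ENNReal.ofReal q * ENNReal.ofReal ((ρ x + ε) ^ s * |φ x| ^ (q - 1) *
          ‖shiftedGrad n κ ε ρ φ x‖) ∂(riemannianVolume n M) := by
        refine lintegral_mono_ae (hHle.mono fun x hx => ?_)
        rw [← ENNReal.ofReal_mul hq0.le]
        refine ENNReal.ofReal_le_ofReal (max_le hx ?_)
        exact mul_nonneg hq0.le (mul_nonneg (mul_nonneg (Real.rpow_nonneg (hr x).le _)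
          (Real.rpow_nonneg (abs_nonneg _) _)) (norm_nonneg _))
    _ = _ := lintegral_const_mul' _ _ ENNReal.ofReal_ne_top

end Hardy

/-! ### The gradient remainder and the limit `ε → 0` -/

section Remainder

open Filter

lemma setLIntegral_eq_lintegral_of_eq_zero {X : Type*} [MeasurableSpace X] {μ : Measure X}
    {s : Set X} (hs : MeasurableSet s) {f : X → ℝ≥0∞} (hf : ∀ x ∉ s, f x = 0) :
    ∫⁻ x in s, f x ∂μ = ∫⁻ x, f x ∂μ := by
  rw [← lintegral_indicator hs, indicator_eq_self.2 fun x hx => by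
    by_contra h; exact hx (hf x h)]

variable {n : ℕ} {M : Type*} [TopologicalSpace M] [T2Space M] [SecondCountableTopology M]
  [ChartedSpace (EucSp n) M] [IsManifold 𝓘(ℝ, EucSp n) ∞ M]
  [RiemannianBundle (fun x : M => TangentSpace 𝓘(ℝ, EucSp n) x)]
  [IsContMDiffRiemannianBundle 𝓘(ℝ, EucSp n) ∞ (EucSp n)
      (fun x : M => TangentSpace 𝓘(ℝ, EucSp n) x)]
  [MeasurableSpace M] [BorelSpace M]

/-- The improved Hardy inequality for the regularised weight `ρ + ε`, with a constant that does not
depend on `ε`. -/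
theorem improved_hardy_shifted {Ω : Set M} (hΩ : IsOpen Ω) {ρ : M → ℝ} (hρ0 : ∀ x, 0 ≤ ρ x)
    (hρL : ChartLipschitz n ρ)
    (hρ : ∀ᵐ x ∂(riemannianVolume n M), ‖grad n ρ x‖ = 1) {C : ℝ} (hC : 0 < C)
    (hΔ : LaplacianGE n ρ fun x => C / ρ x) {ε : ℝ} (hε : 0 < ε) {φ : M → ℝ}
    (hφ : ContMDiff 𝓘(ℝ, EucSp n) 𝓘(ℝ, ℝ) ∞ φ) (hφc : HasCompactSupport φ) (hφΩ : tsupport φ ⊆ Ω)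
    {α κ q : ℝ} (hκ : 0 < κ) (hκC : 2 * κ = C + α - 1) (hq : 1 < q) (hq2 : q < 2) {C₁ : ℝ≥0∞}
    (hC₁ : C₁ * (ENNReal.ofReal ((1 + κ * (q / ((1 + C) * (1 - q / 2)))) ^ 2) *
      riemannianVolume n M Ω ^ (2 / q - 1)) ≤ 1) :
    ENNReal.ofReal (κ ^ 2) * ∫⁻ x in Ω, ENNReal.ofReal
        ((ρ x + ε) ^ α * (φ x ^ 2 / (ρ x + ε) ^ 2)) ∂(riemannianVolume n M) +
      C₁ * (∫⁻ x in Ω, ENNReal.ofReal (‖grad n φ x‖ ^ q * (ρ x + ε) ^ (q * α / 2))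
        ∂(riemannianVolume n M)) ^ (2 / q) ≤
      ∫⁻ x in Ω, ENNReal.ofReal ((ρ x + ε) ^ α * ‖grad n φ x‖ ^ 2)
        ∂(riemannianVolume n M) := by
  have hr : ∀ x, 0 < ρ x + ε := fun x => by linarith [hρ0 x]
  have hq0 : 0 < q := by linarith
  have hΩm := hΩ.measurableSet
  have hφ0 : ∀ x ∉ Ω, φ x = 0 := fun x hx =>
    image_eq_zero_of_notMem_tsupport fun h => hx (hφΩ h)
  have hg0 : ∀ x ∉ Ω, grad n φ x = 0 := fun x hx =>
    grad_eq_zero_of_notMem_tsupport fun h => hx (hφΩ h)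
  set X := shiftedGrad n κ ε ρ φ with hX
  have hX0 : ∀ x ∉ Ω, X x = 0 := fun x hx => by
    rw [hX, shiftedGrad, hg0 x hx, hφ0 x hx]; simp
  have h1 := hardy_shifted hρ0 hρL hρ hC hΔ hε hφ hφc hκ hκC
  obtain ⟨hfin, h2⟩ := hardy_Lq_shifted hρ0 hρL hρ hC hΔ hε hφ hφc hκC hq hq2
  have hQ0 : ∀ x ∉ Ω, ENNReal.ofReal ((ρ x + ε) ^ (α / 2 - 1) * |φ x|) ^ q = 0 := fun x hx => by
    simp [hφ0 x hx, ENNReal.zero_rpow_of_pos hq0]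
  rw [← setLIntegral_eq_lintegral_of_eq_zero hΩm
      (f := fun x => ENNReal.ofReal ((ρ x + ε) ^ α * (φ x ^ 2 / (ρ x + ε) ^ 2)))
      (fun x hx => by simp [hφ0 x hx]),
    ← setLIntegral_eq_lintegral_of_eq_zero hΩm
      (f := fun x => ENNReal.ofReal ((ρ x + ε) ^ α * ‖X x‖ ^ 2))
      (fun x hx => by rw [hX0 x hx]; simp),
    ← setLIntegral_eq_lintegral_of_eq_zero hΩm
      (f := fun x => ENNReal.ofReal ((ρ x + ε) ^ α * ‖grad n φ x‖ ^ 2))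
      (fun x hx => by rw [hg0 x hx]; simp)] at h1
  rw [← setLIntegral_eq_lintegral_of_eq_zero hΩm hQ0] at hfin
  rw [← setLIntegral_eq_lintegral_of_eq_zero hΩm hQ0,
    ← setLIntegral_eq_lintegral_of_eq_zero hΩm
      (f := fun x => ENNReal.ofReal ((ρ x + ε) ^ (α / 2 - 1) * |φ x|) ^ (q - 1) *
        ENNReal.ofReal ((ρ x + ε) ^ (α / 2) * ‖X x‖))
      (fun x hx => by rw [hX0 x hx]; simp)] at h2
  refine le_trans (add_le_add_right ?_ _) h1
  have hρm : Measurable ρ := hρL.continuous.measurable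
  have hmP : AEMeasurable (fun x => ENNReal.ofReal ((ρ x + ε) ^ (α / 2) * ‖X x‖))
      ((riemannianVolume n M).restrict Ω) :=
    ((((hρm.add_const ε).pow_const (α / 2)).aemeasurable.mul (aemeasurable_norm_shiftedGrad
      hρL.continuous hφ.continuous κ ε)).ennreal_ofReal).restrict
  have hmQ : AEMeasurable (fun x => ENNReal.ofReal ((ρ x + ε) ^ (α / 2 - 1) * |φ x|))
      ((riemannianVolume n M).restrict Ω) :=
    (((hρm.add_const ε).pow_const (α / 2 - 1)).mul
      hφ.continuous.abs.measurable).ennreal_ofReal.aemeasurable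
  have h3 := sq_Lq_le_sq_L2 (R := fun x => ENNReal.ofReal ((ρ x + ε) ^ (α / 2) * ‖grad n φ x‖))
    hq hq2.le (mul_pos (by linarith) (by linarith) : 0 < (1 + C) * (1 - q / 2)) hκ.le
    hmP hmQ hfin h2 (by
      filter_upwards [ae_restrict_of_ae hρ] with x hx
      have hpos : 0 ≤ (ρ x + ε) ^ (α / 2) := Real.rpow_nonneg (hr x).le _
      rw [← ENNReal.ofReal_mul hκ.le, ← ENNReal.ofReal_add (by positivity)
        (mul_nonneg hκ.le (mul_nonneg (Real.rpow_nonneg (hr x).le _) (abs_nonneg _)))]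
      refine ENNReal.ofReal_le_ofReal ?_
      -- Undoing the shift with the triangle inequality gives the hypothesis `R ≤ P + κ Q` of
      -- `sq_Lq_le_sq_L2`.
      have h4 : ‖grad n φ x‖ ≤ ‖X x‖ + κ * |φ x| / (ρ x + ε) := by
        have h5 : grad n φ x = X x - (κ * φ x / (ρ x + ε)) • grad n ρ x := by
          rw [hX, shiftedGrad]; abel
        rw [h5]
        refine (norm_sub_le _ _).trans_eq ?_
        rw [norm_smul, hx, mul_one, norm_div, norm_mul, Real.norm_of_nonneg hκ.le,
          Real.norm_of_nonneg (hr x).le, Real.norm_eq_abs]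
      rw [Real.rpow_sub_one (hr x).ne']
      calc (ρ x + ε) ^ (α / 2) * ‖grad n φ x‖
          ≤ (ρ x + ε) ^ (α / 2) * (‖X x‖ + κ * |φ x| / (ρ x + ε)) := by gcongr
        _ = _ := by ring)
  rw [Measure.restrict_apply_univ] at h3
  have hR : ∀ x, ENNReal.ofReal ((ρ x + ε) ^ (α / 2) * ‖grad n φ x‖) ^ q =
      ENNReal.ofReal (‖grad n φ x‖ ^ q * (ρ x + ε) ^ (q * α / 2)) := by
    intro x
    have hpos : 0 ≤ (ρ x + ε) ^ (α / 2) := Real.rpow_nonneg (hr x).le _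
    rw [ENNReal.ofReal_rpow_of_nonneg (by positivity) hq0.le,
      Real.mul_rpow hpos (norm_nonneg _), ← Real.rpow_mul (hr x).le, mul_comm,
      show α / 2 * q = q * α / 2 by ring]
  have hP : ∀ x, ENNReal.ofReal ((ρ x + ε) ^ (α / 2) * ‖X x‖) ^ (2 : ℝ) =
      ENNReal.ofReal ((ρ x + ε) ^ α * ‖X x‖ ^ 2) := by
    intro x
    have hpos : 0 ≤ (ρ x + ε) ^ (α / 2) := Real.rpow_nonneg (hr x).le _
    rw [ENNReal.ofReal_rpow_of_nonneg (by positivity) zero_le_two,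
      Real.mul_rpow hpos (norm_nonneg _), ← Real.rpow_mul (hr x).le, Real.rpow_two]
    congr 3
    ring
  simp only [hR, hP] at h3
  calc _ ≤ C₁ * (ENNReal.ofReal ((1 + κ * (q / ((1 + C) * (1 - q / 2)))) ^ 2) *
      riemannianVolume n M Ω ^ (2 / q - 1) *
        ∫⁻ x in Ω, ENNReal.ofReal ((ρ x + ε) ^ α * ‖X x‖ ^ 2) ∂(riemannianVolume n M)) :=
        mul_le_mul_right h3 _
    _ ≤ 1 * ∫⁻ x in Ω, ENNReal.ofReal ((ρ x + ε) ^ α * ‖X x‖ ^ 2) ∂(riemannianVolume n M) := by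
        rw [← mul_assoc]
        exact mul_le_mul_left hC₁ _
    _ = _ := one_mul _

/-- The improved Hardy inequality on a set of finite volume. -/
theorem improved_hardy {Ω : Set M} (hΩ : IsOpen Ω) {ρ : M → ℝ} (hρ0 : ∀ x, 0 ≤ ρ x)
    (hρL : ChartLipschitz n ρ)
    (hρ : ∀ᵐ x ∂(riemannianVolume n M), ‖grad n ρ x‖ = 1) {C : ℝ} (hC : 0 < C)
    (hΔ : LaplacianGE n ρ fun x => C / ρ x) {φ : M → ℝ}
    (hφ : ContMDiff 𝓘(ℝ, EucSp n) 𝓘(ℝ, ℝ) ∞ φ) (hφc : HasCompactSupport φ) (hφΩ : tsupport φ ⊆ Ω)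
    {α κ q : ℝ} (hκ : 0 < κ) (hκC : 2 * κ = C + α - 1) (hq : 1 < q) (hq2 : q < 2) {C₁ : ℝ≥0∞}
    (hC₁t : C₁ ≠ ⊤)
    (hC₁ : C₁ * (ENNReal.ofReal ((1 + κ * (q / ((1 + C) * (1 - q / 2)))) ^ 2) *
      riemannianVolume n M Ω ^ (2 / q - 1)) ≤ 1) :
    ENNReal.ofReal (κ ^ 2) * ∫⁻ x in Ω, ENNReal.ofReal
        (ρ x ^ α * (φ x ^ 2 / ρ x ^ 2)) ∂(riemannianVolume n M) +
      C₁ * (∫⁻ x in Ω, ENNReal.ofReal (‖grad n φ x‖ ^ q * ρ x ^ (q * α / 2))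
        ∂(riemannianVolume n M)) ^ (2 / q) ≤
      ∫⁻ x in Ω, ENNReal.ofReal (ρ x ^ α * ‖grad n φ x‖ ^ 2)
        ∂(riemannianVolume n M) := by
  have hq0 : 0 < q := by linarith
  set ν := (riemannianVolume n M).restrict Ω with hν
  set ε : ℕ → ℝ := fun k => 1 / ((k : ℝ) + 1) with hε
  have hε0 : ∀ k, 0 < ε k := fun k => by positivity
  have hεlim : Tendsto ε atTop (𝓝 0) := tendsto_one_div_add_atTop_nhds_zero_nat
  have hρlim : ∀ x, Tendsto (fun k => ρ x + ε k) atTop (𝓝 (ρ x)) := fun x => by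
    simpa using hεlim.const_add (ρ x)
  have hpos : ∀ᵐ x ∂ν, 0 < ρ x := ae_restrict_of_ae (ae_pos_of_norm_grad_eq_one hρ0 hρ)
  have hpow : ∀ x, 0 < ρ x → ∀ t : ℝ,
      Tendsto (fun k => (ρ x + ε k) ^ t) atTop (𝓝 (ρ x ^ t)) := fun x hx t =>
    (Real.continuousAt_rpow_const (ρ x) t (Or.inl hx.ne')).tendsto.comp (hρlim x)
  have hρm : Measurable ρ := hρL.continuous.measurable
  have hρεm : ∀ k (t : ℝ), Measurable fun x => (ρ x + ε k) ^ t := fun k t =>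
    (hρm.add_const _).pow_const t
  have hgm : AEMeasurable (fun x => ‖grad n φ x‖) ν := (aemeasurable_norm_grad φ).restrict
  set a : ℕ → ℝ≥0∞ := fun k => ∫⁻ x, ENNReal.ofReal ((ρ x + ε k) ^ α * ‖grad n φ x‖ ^ 2) ∂ν with ha
  -- Fatou's lemma handles both terms on the left, the weights converging wherever `ρ > 0`, that is
  -- almost everywhere.
  have hB : ∫⁻ x, ENNReal.ofReal (ρ x ^ α * (φ x ^ 2 / ρ x ^ 2)) ∂ν ≤ liminf (fun k =>
      ∫⁻ x, ENNReal.ofReal ((ρ x + ε k) ^ α * (φ x ^ 2 / (ρ x + ε k) ^ 2)) ∂ν) atTop := by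
    refine le_trans (lintegral_mono_ae ?_) (lintegral_liminf_le' fun k => ?_)
    · filter_upwards [hpos] with x hx
      refine (Tendsto.liminf_eq (ENNReal.tendsto_ofReal ?_)).ge
      exact (hpow x hx α).mul (tendsto_const_nhds.div ((hρlim x).pow 2) (by positivity))
    · exact ((hρεm k α).mul ((hφ.continuous.measurable.pow_const 2).div
        ((hρm.add_const _).pow_const 2))).ennreal_ofReal.aemeasurable
  have hD : ∫⁻ x, ENNReal.ofReal (‖grad n φ x‖ ^ q * ρ x ^ (q * α / 2)) ∂ν ≤ liminf (fun k =>
      ∫⁻ x, ENNReal.ofReal (‖grad n φ x‖ ^ q * (ρ x + ε k) ^ (q * α / 2)) ∂ν) atTop := by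
    refine le_trans (lintegral_mono_ae ?_) (lintegral_liminf_le' fun k => ?_)
    · filter_upwards [hpos] with x hx
      exact (Tendsto.liminf_eq (ENNReal.tendsto_ofReal ((hpow x hx _).const_mul _))).ge
    · exact ((hgm.pow_const q).mul (hρεm k _).aemeasurable).ennreal_ofReal
  -- The right side needs the opposite inequality. For `α ≥ 0` the weights are dominated by the one
  -- with `ε = 1`; for `α < 0` they stay below the limit weight, whose integral may be infinite.
  have hA : liminf a atTop ≤ ∫⁻ x, ENNReal.ofReal (ρ x ^ α * ‖grad n φ x‖ ^ 2) ∂ν := by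
    rcases le_or_gt 0 α with hα | hα
    · refine (Tendsto.liminf_eq (tendsto_lintegral_of_dominated_convergence'
        (fun x => ENNReal.ofReal ((ρ x + 1) ^ α * ‖grad n φ x‖ ^ 2)) (fun k => ?_) (fun k => ?_)
        ?_ ?_)).le
      · exact ((hρεm k α).aemeasurable.mul (hgm.pow_const 2)).ennreal_ofReal
      · refine ae_of_all _ fun x => ENNReal.ofReal_le_ofReal ?_
        have h1 : ε k ≤ 1 := by
          rw [hε]; exact (div_le_one (by positivity)).2 (by simp)
        have h2 : (ρ x + ε k) ^ α ≤ (ρ x + 1) ^ α :=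
          Real.rpow_le_rpow (add_nonneg (hρ0 x) (hε0 k).le) (by linarith) hα
        gcongr
      · exact ((integrable_weight_mul_norm_grad_sq hρ0 hρL.continuous one_pos hφ hφc
          α).restrict.lintegral_lt_top).ne
      · filter_upwards [hpos] with x hx
        exact ENNReal.tendsto_ofReal ((hpow x hx _).mul_const _)
    · have h1 : ∀ k, a k ≤ ∫⁻ x, ENNReal.ofReal (ρ x ^ α * ‖grad n φ x‖ ^ 2) ∂ν := by
        intro k
        refine lintegral_mono_ae ?_
        filter_upwards [hpos] with x hx
        refine ENNReal.ofReal_le_ofReal (mul_le_mul_of_nonneg_right ?_ (sq_nonneg _))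
        exact Real.rpow_le_rpow_of_nonpos hx (by linarith [hε0 k]) hα.le
      exact (liminf_le_liminf (Eventually.of_forall h1)).trans_eq (liminf_const _)
  refine le_trans ?_ ((mul_liminf_add_le_liminf ENNReal.ofReal_ne_top hC₁t
    (by positivity : 0 < 2 / q) fun k => improved_hardy_shifted hΩ hρ0 hρL hρ hC hΔ (hε0 k) hφ hφc
      hφΩ hκ hκC hq hq2 hC₁).trans hA)
  gcongr

end Remainder

/-- The constant in the improved Hardy inequality, on a set of volume at most `V`. -/
lemma hardy_constant_mul_le_one {q α C κ : ℝ} (hq : 1 < q) (hq2 : q < 2) (hC : 0 < C) (hκ : 0 < κ)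
    (hκC : 2 * κ = C + α - 1) {V : ℝ≥0∞} (hV : V ≠ ⊤) :
    ENNReal.ofReal (1 / ((1 + (1 + |α|) * (q / (2 - q))) ^ 2 * (V.toReal + 1) ^ (2 / q - 1))) *
      (ENNReal.ofReal ((1 + κ * (q / ((1 + C) * (1 - q / 2)))) ^ 2) * V ^ (2 / q - 1)) ≤ 1 := by
  have h2q : 0 < 2 - q := by linarith
  have hq0 : 0 < q := by linarith
  have he : 0 ≤ 2 / q - 1 := by rw [sub_nonneg, le_div_iff₀ hq0]; linarith
  have hV1 : V ^ (2 / q - 1) ≤ ENNReal.ofReal ((V.toReal + 1) ^ (2 / q - 1)) := by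
    rw [← ENNReal.ofReal_rpow_of_nonneg (by positivity) he]
    refine ENNReal.rpow_le_rpow ?_ he
    conv_lhs => rw [← ENNReal.ofReal_toReal hV]
    exact ENNReal.ofReal_le_ofReal (by linarith)
  -- Uniformity in `C` rests on `(C + α - 1) / (1 + C) ≤ 1 + |α|`.
  have hK : κ * (q / ((1 + C) * (1 - q / 2))) ≤ (1 + |α|) * (q / (2 - q)) := by
    have h1 : κ * (q / ((1 + C) * (1 - q / 2))) = (C + α - 1) / (1 + C) * (q / (2 - q)) := by
      rw [← hκC, show 1 - q / 2 = (2 - q) / 2 by ring]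
      have : 1 + C ≠ 0 := by positivity
      field_simp
    rw [h1]
    gcongr
    rw [div_le_iff₀ (by positivity)]
    nlinarith [le_abs_self α, abs_nonneg α]
  have hc : 0 < (1 + C) * (1 - q / 2) := mul_pos (by linarith) (by linarith)
  have hK0 : 0 ≤ κ * (q / ((1 + C) * (1 - q / 2))) := by positivity
  set K₀ := 1 + (1 + |α|) * (q / (2 - q)) with hK₀
  have hK₀pos : 0 < K₀ := by positivity
  set W := (V.toReal + 1) ^ (2 / q - 1) with hW
  have hWpos : 0 < W := by positivity
  calc _ ≤ ENNReal.ofReal (1 / (K₀ ^ 2 * W)) * (ENNReal.ofReal (K₀ ^ 2) * ENNReal.ofReal W) := by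
        gcongr
        linarith
    _ = 1 := by
        rw [← ENNReal.ofReal_mul (by positivity), ← ENNReal.ofReal_mul (by positivity),
          one_div_mul_cancel (by positivity), ENNReal.ofReal_one]

end RiemHardy

end

/-! ### The improved Hardy inequality -/

theorem theorem2p3 (n : ℕ) (M : Type*) [MetricSpace M] [SecondCountableTopology M]
    [ChartedSpace (RiemHardy.EucSp n) M] [IsManifold 𝓘(ℝ, RiemHardy.EucSp n) ∞ M]
    [RiemannianBundle (fun x : M => TangentSpace 𝓘(ℝ, RiemHardy.EucSp n) x)]
    [IsContMDiffRiemannianBundle 𝓘(ℝ, RiemHardy.EucSp n) ∞ (RiemHardy.EucSp n)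
      (fun x : M => TangentSpace 𝓘(ℝ, RiemHardy.EucSp n) x)]
    [IsRiemannianManifold 𝓘(ℝ, RiemHardy.EucSp n) M]
    [CompleteSpace M] [NoncompactSpace M] [MeasurableSpace M] [BorelSpace M]
    (Ω : Set M) (hΩ_open : IsOpen Ω) (hΩ_conn : IsConnected Ω) (hΩ_bdd : Bornology.IsBounded Ω)
    (q : ℝ) (hq₁ : 1 < q) (hq₂ : q < 2) (α : ℝ) :
    ∃ C₁ : ℝ, 0 < C₁ ∧
      ∀ C : ℝ, 0 < C → 0 < C + α - 1 →
      ∀ ρ : M → ℝ, (∀ x, 0 ≤ ρ x) → LocallyLipschitz ρ →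
        (∀ᵐ x ∂(RiemHardy.riemannianVolume n M), ‖RiemHardy.grad n ρ x‖ = 1) →
        RiemHardy.LaplacianGE n ρ (fun x => C / ρ x) →
      ∀ φ : M → ℝ, ContMDiff 𝓘(ℝ, RiemHardy.EucSp n) 𝓘(ℝ, ℝ) ∞ φ →
        HasCompactSupport φ → tsupport φ ⊆ Ω →
        ∫⁻ x in Ω, ENNReal.ofReal (ρ x ^ α * ‖RiemHardy.grad n φ x‖ ^ 2)
            ∂(RiemHardy.riemannianVolume n M) ≥
          ENNReal.ofReal (((C + α - 1) / 2) ^ 2) *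
              ∫⁻ x in Ω, ENNReal.ofReal (ρ x ^ α * (φ x ^ 2 / ρ x ^ 2))
                ∂(RiemHardy.riemannianVolume n M) +
            ENNReal.ofReal C₁ *
              (∫⁻ x in Ω, ENNReal.ofReal
                  (‖RiemHardy.grad n φ x‖ ^ q * ρ x ^ (q * α / 2))
                ∂(RiemHardy.riemannianVolume n M)) ^ (2 / q) := by
  have : ProperSpace M := RiemHardy.properSpace_of_complete n M
  have hV : RiemHardy.riemannianVolume n M Ω ≠ ⊤ := hΩ_bdd.measure_lt_top.ne
  have h2q : 0 < 2 - q := by linarith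
  -- Adding `1` to the volume keeps the denominator positive whatever the volume of `Ω`.
  refine ⟨1 / ((1 + (1 + |α|) * (q / (2 - q))) ^ 2 *
    ((RiemHardy.riemannianVolume n M Ω).toReal + 1) ^ (2 / q - 1)), by positivity, ?_⟩
  intro C hC hCα ρ hρ0 hρL hρ hΔ φ hφ hφc hφΩ
  exact RiemHardy.improved_hardy hΩ_open hρ0 (RiemHardy.chartLipschitz_of_locallyLipschitz n hρL)
    hρ hC hΔ hφ hφc hφΩ (half_pos hCα) (mul_div_cancel₀ _ two_ne_zero) hq₁ hq₂
    ENNReal.ofReal_ne_top (RiemHardy.hardy_constant_mul_le_one hq₁ hq₂ hC (half_pos hCα)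
      (mul_div_cancel₀ _ two_ne_zero) hV)
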